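/- Write $f=o_\infty(r^{k})$ for a function on $\mathbb{R}^n$ if $\partial^{I}f=o(r^{k-|I|})$ as $r=|x|\to\infty$ for every multi-index $I$. Let $\gamma_{ab}$ be a smooth Riemannian metric and $K_{ab}$ a smooth symmetric tensor on $\mathbb{R}^3$ with Cartesian coordinates $(x,y,z)$, and let $x=\rho\cos\phi$, $y=\rho\sin\phi$. Assume * asymptotic flatness: $\gamma_{\mu\nu}=\delta_{\mu\nu}+o_\infty(r^{-1/2})$ and $K_{\mu\nu}=o_\infty(r^{-3/2})$ in these coordinates; * axial symmetry: $\mathcal{L}_\eta\gamma=0$ and $\mathcal{L}_\eta K=0$ (Lie derivatives) for $\eta=\partial_\phi=-y\,\partial_x+x\,\partial_y$; * the coordinates are isothermal: with $\lambda^2=\gamma_{ab}\eta^a\eta^b$, the quotient metric $q_{ab}=\gamma_{ab}-\eta_a\eta_b/\lambda^2$ has the form $q=e^{2u}(d\rho^2+dz^2)$ with a smooth function $u$. Let $\alpha$ be the lapse of the maximal gauge: a smooth strictly positive function on $\mathbb{R}^3$ with $\Delta_\gamma\alpha=\alpha K^{ab}K_{ab}$ and $\alpha-1=o_\infty(r^{-1/2})$.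 Let $\chi_{ab}=q_a^c q_b^d K_{cd}$, $\chi=q^{ab}\chi_{ab}$, $k_{ab}=\chi_{ab}-\tfrac12 q_{ab}\chi$ and $k^a_b=q^{ac}k_{cb}$. Regard $q_{ab},\chi_{ab},k_{ab},\alpha$ as fields of $(\rho,z)\in\mathbb{R}^2$, extended across the axis to $\rho\le 0$ by identifying $(\rho,z)$ with the point $(x,y,z)=(\rho,0,z)$ of the plane $y=0$. All indices $a,b$ below range over $\rho,z$. Then there is a unique smooth vector field $\beta^a$ on $\mathbb{R}^2$ such that $$\Delta\beta^a=2\,\partial^b(\alpha k_b^a),\qquad \beta^a=o_\infty(r^{-1/2}),$$ where $\Delta=\partial_\rho^2+\partial_z^2$, the index of $\partial^b$ is raised with the flat metric, and $r=\sqrt{\rho^2+z^2}$. This solution satisfies the parity conditions $$\beta^\rho(-\rho,z)=-\beta^\rho(\rho,z),\qquad \beta^z(-\rho,z)=\beta^z(\rho,z)$$ and the gauge equation $$(\mathcal{L}_q\beta)_{ab}=2\alpha k_{ab},\qquad (\mathcal{L}_q\beta)_{ab}:=D_a\beta_b+D_b\beta_a-q_{ab}D_c\beta^c,$$ with $D$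 the Levi-Civita connection of $q$. Moreover $\beta^\rho/\rho$ extends to a smooth function on $\mathbb{R}^2$, and $\beta^\rho/\rho=o_\infty(r^{-3/2})$. -/

import Mathlib

open scoped ContDiff BigOperators

noncomputable section

namespace AxiGauge

/-- Euclidean space `ℝⁿ` with its Cartesian coordinates `p 0, …, p (n - 1)`; the Euclidean radius
of `p` is `‖p‖`. -/
abbrev E (n : ℕ) : Type := EuclideanSpace ℝ (Fin n)

/-- Covariant 2-tensor fields on `ℝⁿ`, through their components in the Cartesian coordinates. -/
abbrev Tensor2 (n : ℕ) : Type := E n → Matrix (Fin n) (Fin n) ℝ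

/-- The partial derivative `∂_i f`. -/
def pd {n : ℕ} (i : Fin n) (f : E n → ℝ) : E n → ℝ :=
  fun p => fderiv ℝ f p (EuclideanSpace.single i 1)

/-- The iterated partial derivative `∂_{i₁} ⋯ ∂_{iₘ} f` for a list `[i₁, …, iₘ]` of indices. -/
def pdList {n : ℕ} (I : List (Fin n)) (f : E n → ℝ) : E n → ℝ :=
  I.foldr (fun i g => pd i g) f

/-- `f = o_∞(r^k)`: `∂^I f = o(r^(k - |I|))` as `r → ∞`, for every multi-index `I`. -/
def IsLittleOInfty {n : ℕ} (k : ℝ) (f : E n → ℝ) : Prop :=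
  ∀ I : List (Fin n),
    (pdList I f) =o[Bornology.cobounded (E n)] (fun p : E n => ‖p‖ ^ (k - (I.length : ℝ)))

/-- Smoothness of a tensor field: all components are smooth. -/
def SmoothTensor {n : ℕ} (T : Tensor2 n) : Prop :=
  ∀ a b, ContDiff ℝ ∞ (fun p => T p a b)

/-! ### Riemannian geometry in coordinates -/

/-- Christoffel symbols `Γ^c_{ab}` of the metric `g`. -/
def christoffel {n : ℕ} (g : Tensor2 n) (c a b : Fin n) (p : E n) : ℝ :=
  (1 / 2 : ℝ) * ∑ d, (g p)⁻¹ c d *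
    (pd a (fun x => g x d b) p + pd b (fun x => g x d a) p - pd d (fun x => g x a b) p)

/-- The Laplacian `Δ_g f = g^{ab} (∂_a ∂_b f - Γ^c_{ab} ∂_c f)` of a function. -/
def laplacian {n : ℕ} (g : Tensor2 n) (f : E n → ℝ) (p : E n) : ℝ :=
  ∑ a, ∑ b, (g p)⁻¹ a b * (pd a (pd b f) p - ∑ c, christoffel g c a b p * pd c f p)

/-- Lowering the index of a vector field: `β_a = g_{ab} β^b`. -/
def lower {n : ℕ} (g : Tensor2 n) (β : Fin n → E n → ℝ) (a : Fin n) (p : E n) : ℝ :=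
  ∑ b, g p a b * β b p

/-- Covariant derivative `D_a w_b = ∂_a w_b - Γ^c_{ab} w_c` of a one-form. -/
def covDeriv {n : ℕ} (g : Tensor2 n) (w : Fin n → E n → ℝ) (a b : Fin n) (p : E n) : ℝ :=
  pd a (w b) p - ∑ c, christoffel g c a b p * w c p

/-- Divergence `D_c β^c = ∂_c β^c + Γ^c_{cd} β^d` of a vector field. -/
def divergence {n : ℕ} (g : Tensor2 n) (β : Fin n → E n → ℝ) (p : E n) : ℝ :=
  ∑ c, (pd c (β c) p + ∑ d, christoffel g c c d p * β d p)

/-- The conformal Killing operator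
`(L_g β)_{ab} = D_a β_b + D_b β_a - g_{ab} D_c β^c` in dimension two. -/
def conformalKilling (g : Tensor2 2) (β : Fin 2 → E 2 → ℝ) (a b : Fin 2) (p : E 2) : ℝ :=
  covDeriv g (lower g β) a b p + covDeriv g (lower g β) b a p - g p a b * divergence g β p

/-- Lie derivative of a covariant 2-tensor field `T` along the vector field `η`:
`η^c ∂_c T_{ab} + T_{cb} ∂_a η^c + T_{ac} ∂_b η^c`. -/
def lieDeriv {n : ℕ} (η : Fin n → E n → ℝ) (T : Tensor2 n) (a b : Fin n) (p : E n) : ℝ :=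
  ∑ c, (η c p * pd c (fun x => T x a b) p + T p c b * pd a (η c) p + T p a c * pd b (η c) p)

/-! ### Axially symmetric asymptotically flat initial data on `ℝ³`

The coordinates `(x, y, z)` are `p 0, p 1, p 2`. -/

/-- The axial vector field `η = ∂_φ = -y ∂_x + x ∂_y`. -/
def axialField : Fin 3 → E 3 → ℝ :=
  ![fun p => -p 1, fun p => p 0, fun _ => 0]

/-- `(γ, K)` is an axially symmetric, asymptotically flat initial data set on `ℝ³`, in coordinates
in which the axial Killing field is `∂_φ`. -/
structure IsAxisymAFData (γ K : Tensor2 3) : Prop where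
  smooth_metric : SmoothTensor γ
  smooth_curv : SmoothTensor K
  posDef_metric : ∀ p, (γ p).PosDef
  symm_curv : ∀ p, (K p).IsSymm
  killing_metric : ∀ a b p, lieDeriv axialField γ a b p = 0
  killing_curv : ∀ a b p, lieDeriv axialField K a b p = 0
  flat_metric : ∀ a b,
    IsLittleOInfty (-1 / 2) (fun p => γ p a b - (1 : Matrix (Fin 3) (Fin 3) ℝ) a b)
  flat_curv : ∀ a b, IsLittleOInfty (-3 / 2) (fun p => K p a b)

/-- `K^{ab} K_{ab}`, indices raised with `γ`. -/
def curvSq (γ K : Tensor2 3) (p : E 3) : ℝ :=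
  ∑ a, ∑ b, ∑ c, ∑ d, (γ p)⁻¹ a c * (γ p)⁻¹ b d * K p a b * K p c d

/-- `α` is the lapse of the maximal gauge: a smooth strictly positive solution of
`Δ_γ α = α K^{ab} K_{ab}` with `α - 1 = o_∞(r^{-1/2})`. -/
structure IsMaximalLapse (γ K : Tensor2 3) (α : E 3 → ℝ) : Prop where
  smooth : ContDiff ℝ ∞ α
  pos : ∀ p, 0 < α p
  eqn : ∀ p, laplacian γ α p = α p * curvSq γ K p
  decay : IsLittleOInfty (-1 / 2) (fun p => α p - 1)

/-- The squared norm `λ² = γ_{ab} η^a η^b` of the axial Killing field. -/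
def normSqAxial (γ : Tensor2 3) (p : E 3) : ℝ :=
  ∑ a, ∑ b, γ p a b * axialField a p * axialField b p

/-- The quotient metric `q_{ab} = γ_{ab} - η_a η_b / λ²` as a tensor field on `ℝ³`. On the axis,
where `η = 0`, the last term is `0 / 0 = 0`; for axially symmetric `γ` the components of this tensor
in the `(x, z)`-directions are then still the limits along the plane `y = 0`. -/
def quotientMetric3 (γ : Tensor2 3) : Tensor2 3 := fun p =>
  Matrix.of fun a b =>
    γ p a b - lower γ axialField a p * lower γ axialField b p / normSqAxial γ p

/-- The projection `q^c_a = δ^c_a - η^c η_a / λ²`. -/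
def proj (γ : Tensor2 3) (c a : Fin 3) (p : E 3) : ℝ :=
  (1 : Matrix (Fin 3) (Fin 3) ℝ) c a - axialField c p * lower γ axialField a p / normSqAxial γ p

/-- The projected extrinsic curvature `χ_{ab} = q^c_a q^d_b K_{cd}` as a tensor field on `ℝ³`. -/
def quotientCurv3 (γ K : Tensor2 3) : Tensor2 3 := fun p =>
  Matrix.of fun a b => ∑ c, ∑ d, proj γ c a p * proj γ d b p * K p c d

/-- The meridian plane `y = 0`, with coordinates `(ρ, z) = (p 0, p 1) ∈ ℝ²`. On it, for `ρ > 0`,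
`∂_ρ = ∂_x`; negative `ρ` gives the extension of the fields across the axis. -/
def meridian (p : E 2) : E 3 := !₂[p 0, 0, p 1]

/-- The indices of the coordinates `ρ = x` and `z`. -/
def meridianIndex : Fin 2 → Fin 3 := ![0, 2]

/-- The `(ρ, z)`-components of a tensor field of `ℝ³` on the meridian plane. -/
def restrict (T : Tensor2 3) : Tensor2 2 := fun p =>
  Matrix.of fun i j => T (meridian p) (meridianIndex i) (meridianIndex j)

/-- The quotient metric `q` in the coordinates `(ρ, z)`. -/
def qMetric (γ : Tensor2 3) : Tensor2 2 := restrict (quotientMetric3 γ)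

/-- The extrinsic curvature `χ` of the quotient slice in the coordinates `(ρ, z)`. -/
def chi (γ K : Tensor2 3) : Tensor2 2 := restrict (quotientCurv3 γ K)

/-- The trace `χ = q^{ab} χ_{ab}`. -/
def chiTrace (γ K : Tensor2 3) (p : E 2) : ℝ :=
  ∑ a, ∑ b, (qMetric γ p)⁻¹ a b * chi γ K p a b

/-- The trace-free part `k_{ab} = χ_{ab} - q_{ab} χ / 2`. -/
def kLow (γ K : Tensor2 3) : Tensor2 2 := fun p =>
  Matrix.of fun a b => chi γ K p a b - qMetric γ p a b * chiTrace γ K p / 2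

/-- `k_b^a = q^{ac} k_{cb}`. -/
def kMixed (γ K : Tensor2 3) (a b : Fin 2) (p : E 2) : ℝ :=
  ∑ c, (qMetric γ p)⁻¹ a c * kLow γ K p c b

/-- The coordinates are isothermal: `q = e^{2u} (dρ² + dz²)` with a smooth function `u`. -/
def IsIsothermal (γ : Tensor2 3) : Prop :=
  ∃ u : E 2 → ℝ, ContDiff ℝ ∞ u ∧
    ∀ p a b, qMetric γ p a b = Real.exp (2 * u p) * (1 : Matrix (Fin 2) (Fin 2) ℝ) a b

/-- The reflection `(ρ, z) ↦ (-ρ, z)`. -/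
def reflect (p : E 2) : E 2 := !₂[-p 0, p 1]

/-- `β` (with components `β 0 = β^ρ`, `β 1 = β^z`) is a smooth solution on `ℝ²` of
`Δ β^a = 2 ∂^b (α k_b^a)`, with the flat Laplacian and the flat metric to raise the index of `∂^b`,
and with `β^a = o_∞(r^{-1/2})`. -/
structure IsShiftSolution (γ K : Tensor2 3) (α : E 3 → ℝ) (β : Fin 2 → E 2 → ℝ) : Prop where
  smooth : ∀ a, ContDiff ℝ ∞ (β a)
  eqn : ∀ a p, ∑ b, pd b (pd b (β a)) p =
    2 * ∑ b, pd b (fun x => α (meridian x) * kMixed γ K a b x) p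
  decay : ∀ a, IsLittleOInfty (-1 / 2) (β a)

end AxiGauge

end

open AxiGauge

/-! In isothermal coordinates the metric is a conformal factor `w = e^{2u}` times the flat one, and
`α k_b^a` is the symmetric trace-free matrix with entries `a, b; b, -a`. All derivatives of `w` drop
out of the gauge equation, which becomes the inhomogeneous Cauchy–Riemann system `∂_ρ β^ρ - ∂_z β^z
= 2a`, `∂_z β^ρ + ∂_ρ β^z = 2b`. With `B = β^ρ + i β^z` and `F = a + i b` this is `∂B/∂z̄ = F`,
solved by the Cauchy transform `B = F * 1/(πz)` (`dbar_cauchy`, `exists_cauchyRiemann`).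
Cross-differentiation shows that a solution of the first-order system solves the second-order one
(`laplace_of_cauchyRiemann`). So existence and the gauge equation come together, and Liouville's
theorem gives uniqueness (`eq_zero_of_harmonic`).

The analytic core is that the transform sends `o_∞(r^{-3/2})` to `o_∞(r^{-1/2})` (`decays_cauchy`).
The undifferentiated bound is a potential estimate. For derivatives, `∂B/∂z̄` is `F` itself, while
`∂B/∂z` is the transform of `∂F/∂z`, which has vanishing integral. Multiplication by `z` therefore
commutes with the transform there (`mul_cauchy`), and this yields the extra order of decay.

Parity needs the lapse to be invariant under the half turn about the axis. Symmetry of `α` is not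
assumed; it follows from the maximum principle (`lapse_halfTurn`). The tensors are invariant because
their Lie derivatives vanish (`apply_halfTurn`). Then `a` is even and `b` odd in `ρ`, so the
reflected shift is again a solution and uniqueness applies. Finally `β^ρ` vanishes on the axis, and
`β^ρ/ρ` is controlled by Hadamard's formula near the axis and by plain division away from it
(`exists_div_rho`). -/

namespace AxiGauge

open Filter Asymptotics Bornology
open scoped Topology

/-! ### Functions decaying together with their derivatives -/

section Decay

variable {V V' W W' : Type*} [NormedAddCommGroup V] [NormedSpace ℝ V] [NormedAddCommGroup V']
  [NormedSpace ℝ V'] [NormedAddCommGroup W] [NormedSpace ℝ W] [NormedAddCommGroup W']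
  [NormedSpace ℝ W'] {A : Type*} [NormedField A] [NormedAlgebra ℝ A]

/-- The derivative of `f` in the fixed direction `v`. -/
noncomputable def dirD (v : V) (f : V → W) : V → W := fun x => fderiv ℝ f x v

/-- `f` and its derivatives up to order `n` are `o(r^(k - order))` along `l`. -/
def DecaysN (l : Filter V) : ℕ → ℝ → (V → W) → Prop
  | 0, k, f => f =o[l] fun x => ‖x‖ ^ k
  | n + 1, k, f => (f =o[l] fun x => ‖x‖ ^ k) ∧ ∀ v, DecaysN l n (k - 1) (dirD v f)

/-- `f` is smooth, and `f = o_∞(r^k)`. -/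
def Decays (k : ℝ) (f : V → W) : Prop :=
  ContDiff ℝ ∞ f ∧ ∀ n, DecaysN (cobounded V) n k f

lemma contDiff_dirD {f : V → W} (hf : ContDiff ℝ ∞ f) (v : V) : ContDiff ℝ ∞ (dirD v f) :=
  (hf.fderiv_right (m := ∞) (by simp)).clm_apply contDiff_const

lemma _root_.ContDiff.differentiable_infty {f : V → W} (hf : ContDiff ℝ ∞ f) : Differentiable ℝ f :=
  hf.differentiable (by simp)

lemma dirD_add {f g : V → W} (hf : Differentiable ℝ f) (hg : Differentiable ℝ g) (v : V) :
    dirD v (fun x => f x + g x) = fun x => dirD v f x + dirD v g x := by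
  ext x; simp [dirD, fderiv_fun_add (hf x) (hg x)]

lemma dirD_sub {f g : V → W} (hf : Differentiable ℝ f) (hg : Differentiable ℝ g) (v : V) :
    dirD v (fun x => f x - g x) = fun x => dirD v f x - dirD v g x := by
  ext x; simp [dirD, fderiv_fun_sub (hf x) (hg x)]

lemma dirD_mul {f g : V → A} (hf : Differentiable ℝ f) (hg : Differentiable ℝ g) (v : V) :
    dirD v (fun x => f x * g x) = fun x => f x * dirD v g x + dirD v f x * g x := by
  ext x; simp [dirD, fderiv_fun_mul (hf x) (hg x), mul_comm]

lemma dirD_clm_comp (L : W →L[ℝ] W') {f : V → W} (hf : Differentiable ℝ f) (v : V) :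
    dirD v (fun x => L (f x)) = fun x => L (dirD v f x) := by
  ext x
  have := (L.hasFDerivAt.comp x (hf x).hasFDerivAt).fderiv
  simp only [dirD]
  change fderiv ℝ (L ∘ f) x v = _
  rw [this]; rfl

lemma dirD_comp_clm (L : V' →L[ℝ] V) {f : V → W} (hf : Differentiable ℝ f) (v : V') :
    dirD v (fun x => f (L x)) = fun x => dirD (L v) f (L x) := by
  ext x
  have := ((hf (L x)).hasFDerivAt.comp x L.hasFDerivAt).fderiv
  change fderiv ℝ (f ∘ L) x v = _
  rw [this]; rfl

lemma dirD_clm (L : V →L[ℝ] W) (v : V) : dirD v (fun x => L x) = fun _ => L v := by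
  ext x; simp [dirD]

lemma dirD_smul_vec (f : V → W) (c : ℝ) (v : V) : dirD (c • v) f = fun x => c • dirD v f x := by
  ext x; simp [dirD]

lemma dirD_comm {f : V → W} (hf : ContDiff ℝ ∞ f) (v w : V) :
    dirD v (dirD w f) = dirD w (dirD v f) := by
  ext x
  have hd : DifferentiableAt ℝ (fderiv ℝ f) x :=
    ((hf.fderiv_right (m := ∞) (by simp)).differentiable_infty) x
  have key : ∀ a b : V, dirD a (dirD b f) x = fderiv ℝ (fderiv ℝ f) x a b := by
    intro a b
    change fderiv ℝ (fun y => fderiv ℝ f y b) x a = _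
    rw [fderiv_clm_apply hd (by fun_prop)]
    simp
  rw [key, key]
  have : IsSymmSndFDerivAt ℝ f x :=
    hf.contDiffAt.isSymmSndFDerivAt
      (by simp only [minSmoothness_of_isRCLikeNormedField]; exact WithTop.coe_le_coe.2 (le_top (a := (2 : ℕ∞))))
  exact this v w

variable {l l' : Filter V}

lemma DecaysN.isLittleO : ∀ {n : ℕ} {k : ℝ} {f : V → W}, DecaysN l n k f →
    f =o[l] fun x => ‖x‖ ^ k
  | 0, _, _, h => h
  | _ + 1, _, _, h => h.1

lemma DecaysN.of_succ : ∀ {n : ℕ} {k : ℝ} {f : V → W}, DecaysN l (n + 1) k f → DecaysN l n k f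
  | 0, _, _, h => h.1
  | _ + 1, _, _, h => ⟨h.1, fun v => (h.2 v).of_succ⟩

lemma DecaysN.filter_mono (hl : l' ≤ l) : ∀ {n : ℕ} {k : ℝ} {f : V → W},
    DecaysN l n k f → DecaysN l' n k f
  | 0, _, _, h => IsLittleO.mono h hl
  | _ + 1, _, _, h => ⟨h.1.mono hl, fun v => (h.2 v).filter_mono hl⟩

/-- General filters are allowed so that decay can be proved separately on two cones covering the
plane and then glued. -/
lemma DecaysN.sup : ∀ {n : ℕ} {k : ℝ} {f : V → W},
    DecaysN l n k f → DecaysN l' n k f → DecaysN (l ⊔ l') n k f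
  | 0, _, _, h, h' => IsLittleO.sup h h'
  | _ + 1, _, _, h, h' => ⟨h.1.sup h'.1, fun v => (h.2 v).sup (h'.2 v)⟩

omit [NormedSpace ℝ V] in
lemma eventually_one_le_norm : ∀ᶠ x in cobounded V, 1 ≤ ‖x‖ :=
  tendsto_norm_cobounded_atTop.eventually_ge_atTop 1

lemma DecaysN.mono (hl : l ≤ cobounded V) : ∀ {n : ℕ} {k k' : ℝ} {f : V → W}, k ≤ k' →
    DecaysN l n k f → DecaysN l n k' f := by
  have key : ∀ {k k' : ℝ}, k ≤ k' → (fun x : V => ‖x‖ ^ k) =O[l] fun x => ‖x‖ ^ k' := by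
    intro k k' h
    refine IsBigO.of_bound 1 ?_
    filter_upwards [hl eventually_one_le_norm] with x hx
    rw [one_mul, Real.norm_of_nonneg (by positivity), Real.norm_of_nonneg (by positivity)]
    exact Real.rpow_le_rpow_of_exponent_le hx h
  intro n
  induction n with
  | zero => exact fun hk h => IsLittleO.trans_isBigO h (key hk)
  | succ n ih =>
    exact fun hk h => ⟨h.1.trans_isBigO (key hk), fun v => ih (by linarith) (h.2 v)⟩

lemma DecaysN.add {n : ℕ} : ∀ {k : ℝ} {f g : V → W}, ContDiff ℝ ∞ f → ContDiff ℝ ∞ g →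
    DecaysN l n k f → DecaysN l n k g → DecaysN l n k (fun x => f x + g x) := by
  induction n with
  | zero => exact fun _ _ h h' => IsLittleO.add h h'
  | succ n ih =>
    intro k f g hf hg h h'
    refine ⟨h.1.add h'.1, fun v => ?_⟩
    rw [dirD_add hf.differentiable_infty hg.differentiable_infty]
    exact ih (contDiff_dirD hf v) (contDiff_dirD hg v) (h.2 v) (h'.2 v)

lemma DecaysN.clm_comp (L : W →L[ℝ] W') {n : ℕ} : ∀ {k : ℝ} {f : V → W}, ContDiff ℝ ∞ f →
    DecaysN l n k f → DecaysN l n k (fun x => L (f x)) := by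
  induction n with
  | zero => exact fun _ h => (L.isBigO_comp _ l).trans_isLittleO h
  | succ n ih =>
    intro k f hf h
    refine ⟨(L.isBigO_comp _ l).trans_isLittleO h.1, fun v => ?_⟩
    rw [dirD_clm_comp L hf.differentiable_infty]
    exact ih (contDiff_dirD hf v) (h.2 v)

lemma DecaysN.mul (hl : l ≤ cobounded V) {n : ℕ} : ∀ {k m : ℝ} {f g : V → A},
    ContDiff ℝ ∞ f → ContDiff ℝ ∞ g → DecaysN l n k f → DecaysN l n m g →
    DecaysN l n (k + m) (fun x => f x * g x) := by
  have key : ∀ {k m : ℝ} {f g : V → A}, (f =o[l] fun x => ‖x‖ ^ k) → (g =o[l] fun x => ‖x‖ ^ m) →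
      (fun x => f x * g x) =o[l] fun x => ‖x‖ ^ (k + m) := by
    intro k m f g hf hg
    refine (hf.mul hg).congr' EventuallyEq.rfl ?_
    filter_upwards [hl eventually_one_le_norm] with x hx
    rw [Real.rpow_add (by linarith)]
  induction n with
  | zero => exact fun _ _ h h' => key h h'
  | succ n ih =>
    intro k m f g hf hg h h'
    refine ⟨key h.1 h'.1, fun v => ?_⟩
    rw [dirD_mul hf.differentiable_infty hg.differentiable_infty]
    have h1 := ih hf (contDiff_dirD hg v) h.of_succ (h'.2 v)
    have h2 := ih (contDiff_dirD hf v) hg (h.2 v) h'.of_succ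
    rw [show k + (m - 1) = k + m - 1 by ring] at h1
    rw [show k - 1 + m = k + m - 1 by ring] at h2
    exact DecaysN.add (hf.mul (contDiff_dirD hg v)) ((contDiff_dirD hf v).mul hg) h1 h2

/-- The derivative of `f ∘ ι` along `v` is that of `f` along `ι v`, so decay stated with all
directions, not just coordinate ones, is transported at once. This serves for the identification of
the plane with `ℂ`, the meridian plane in `ℝ³`, rotations and reflections. -/
lemma DecaysN.comp_isometry (ι : V' →ₗᵢ[ℝ] V) {l' : Filter V'} (hι : Tendsto ι l' l) {n : ℕ} :
    ∀ {k : ℝ} {f : V → W}, ContDiff ℝ ∞ f → DecaysN l n k f →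
      DecaysN l' n k (fun x => f (ι x)) := by
  have key : ∀ {k : ℝ} {f : V → W}, (f =o[l] fun x => ‖x‖ ^ k) →
      (fun x => f (ι x)) =o[l'] fun x => ‖x‖ ^ k := by
    intro k f h
    refine (h.comp_tendsto hι).congr (fun _ => rfl) fun x => ?_
    simp
  induction n with
  | zero => exact fun _ h => key h
  | succ n ih =>
    intro k f hf h
    refine ⟨key h.1, fun v => ?_⟩
    have hd : dirD v (fun x => f (ι x)) = fun x => dirD (ι v) f (ι x) :=
      dirD_comp_clm ι.toContinuousLinearMap hf.differentiable_infty v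
    rw [hd]
    exact ih (contDiff_dirD hf _) (h.2 _)

lemma DecaysN.linear_mul (hl : l ≤ cobounded V) (L : V →L[ℝ] A) {n : ℕ} : ∀ {k : ℝ} {f : V → A},
    ContDiff ℝ ∞ f → DecaysN l n k f → DecaysN l n (k + 1) (fun x => L x * f x) := by
  have key : ∀ {k : ℝ} {f : V → A}, (f =o[l] fun x => ‖x‖ ^ k) →
      (fun x => L x * f x) =o[l] fun x => ‖x‖ ^ (k + 1) := by
    intro k f h
    have h1 : (fun x => L x) =O[l] fun x => ‖x‖ := (L.isBigO_id l).norm_right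
    refine (h1.mul_isLittleO h).congr' EventuallyEq.rfl ?_
    filter_upwards [hl eventually_one_le_norm] with x hx
    rw [Real.rpow_add (by linarith), Real.rpow_one, mul_comm]
  induction n with
  | zero => exact fun _ h => key h
  | succ n ih =>
    intro k f hf h
    refine ⟨key h.1, fun v => ?_⟩
    rw [dirD_mul L.differentiable hf.differentiable_infty, dirD_clm]
    have h1 := ih (contDiff_dirD hf v) (h.2 v)
    have h2 := DecaysN.clm_comp (ContinuousLinearMap.mul ℝ A (L v)) hf h.of_succ
    rw [show k - 1 + 1 = k + 1 - 1 by ring] at h1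
    rw [show k = k + 1 - 1 by ring] at h2
    exact DecaysN.add (L.contDiff.mul (contDiff_dirD hf v))
      ((ContinuousLinearMap.contDiff (ContinuousLinearMap.mul ℝ A (L v))).comp hf) h1 h2

/-- Division by a linear form comparable to `‖x‖` gains an order. The induction uses `L ∂_v f = ∂_v
(L f) - L(v) f`, whose last term is controlled by the inductive hypothesis for `f` itself. It is
applied to the coordinate of `ℂ` and, on a cone, to `ρ`. -/
lemma DecaysN.of_linear_mul (hl : l ≤ cobounded V) (L : V →L[ℝ] A)
    (hL : (fun x : V => ‖x‖) =O[l] fun x => L x) {n : ℕ} : ∀ {k : ℝ} {f : V → A},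
    ContDiff ℝ ∞ f → DecaysN l n k (fun x => L x * f x) → DecaysN l n (k - 1) f := by
  have key : ∀ {k : ℝ} {f : V → A}, ((fun x => L x * f x) =o[l] fun x => ‖x‖ ^ k) →
      f =o[l] fun x => ‖x‖ ^ (k - 1) := by
    intro k f h
    have h1 : (fun x : V => ‖x‖⁻¹ • (‖x‖ • f x)) =o[l] fun x => ‖x‖⁻¹ • ‖x‖ ^ k := by
      refine IsBigO.smul_isLittleO (isBigO_refl _ _) ?_
      refine IsBigO.trans_isLittleO ?_ h
      rw [← isBigO_norm_left, ← isBigO_norm_right]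
      simp only [norm_smul, norm_mul, norm_norm]
      exact hL.norm_right.mul (isBigO_refl _ _)
    refine h1.congr' ?_ ?_
    · filter_upwards [hl eventually_one_le_norm] with x hx
      rw [smul_smul, inv_mul_cancel₀ (by linarith), one_smul]
    · filter_upwards [hl eventually_one_le_norm] with x hx
      rw [Real.rpow_sub (by linarith), Real.rpow_one, smul_eq_mul, div_eq_inv_mul]
  induction n with
  | zero => exact fun _ h => key h
  | succ n ih =>
    intro k f hf h
    refine ⟨key h.1, fun v => ih (contDiff_dirD hf v) ?_⟩
    have h0 := ih hf h.of_succ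
    have h1 := h.2 v
    rw [dirD_mul L.differentiable hf.differentiable_infty, dirD_clm] at h1
    have h2 := DecaysN.clm_comp (-ContinuousLinearMap.mul ℝ A (L v)) hf h0
    have h3 := DecaysN.add ((L.contDiff.mul (contDiff_dirD hf v)).add
      (contDiff_const.mul hf)) ((ContinuousLinearMap.contDiff
        (-ContinuousLinearMap.mul ℝ A (L v))).comp hf) h1 h2
    refine (congrArg (DecaysN l n (k - 1)) ?_).mp h3
    ext x; simp

lemma Decays.mono {k k' : ℝ} {f : V → W} (h : Decays k f) (hk : k ≤ k') : Decays k' f :=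
  ⟨h.1, fun n => (h.2 n).mono le_rfl hk⟩

lemma Decays.add {k : ℝ} {f g : V → W} (hf : Decays k f) (hg : Decays k g) :
    Decays k (fun x => f x + g x) :=
  ⟨hf.1.add hg.1, fun n => (hf.2 n).add hf.1 hg.1 (hg.2 n)⟩

lemma Decays.clm_comp {k : ℝ} {f : V → W} (hf : Decays k f) (L : W →L[ℝ] W') :
    Decays k (fun x => L (f x)) :=
  ⟨L.contDiff.comp hf.1, fun n => (hf.2 n).clm_comp L hf.1⟩

lemma Decays.neg {k : ℝ} {f : V → W} (hf : Decays k f) : Decays k (fun x => -f x) := by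
  simpa using hf.clm_comp (-ContinuousLinearMap.id ℝ W)

lemma Decays.sub {k : ℝ} {f g : V → W} (hf : Decays k f) (hg : Decays k g) :
    Decays k (fun x => f x - g x) := by
  simpa [sub_eq_add_neg] using hf.add hg.neg

lemma Decays.mul {k m : ℝ} {f g : V → A} (hf : Decays k f) (hg : Decays m g) :
    Decays (k + m) (fun x => f x * g x) :=
  ⟨hf.1.mul hg.1, fun n => (hf.2 n).mul le_rfl hf.1 hg.1 (hg.2 n)⟩

lemma Decays.const_mul {k : ℝ} {f : V → A} (hf : Decays k f) (c : A) :
    Decays k (fun x => c * f x) := by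
  simpa using hf.clm_comp (ContinuousLinearMap.mul ℝ A c)

lemma Decays.dirD {k : ℝ} {f : V → W} (hf : Decays k f) (v : V) : Decays (k - 1) (dirD v f) :=
  ⟨contDiff_dirD hf.1 v, fun n => (hf.2 (n + 1)).2 v⟩

lemma Decays.isLittleO {k : ℝ} {f : V → W} (hf : Decays k f) :
    f =o[cobounded V] fun x => ‖x‖ ^ k := (hf.2 0).isLittleO

lemma Decays.comp_isometry {k : ℝ} {f : V → W} (hf : Decays k f) (ι : V' →ₗᵢ[ℝ] V) :
    Decays k (fun x => f (ι x)) :=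
  ⟨hf.1.comp ι.toContinuousLinearMap.contDiff, fun n =>
    (hf.2 n).comp_isometry ι (by
      rw [← tendsto_norm_atTop_iff_cobounded]
      simpa using tendsto_norm_cobounded_atTop) hf.1⟩

lemma Decays.linear_mul {k : ℝ} {f : V → A} (hf : Decays k f) (L : V →L[ℝ] A) :
    Decays (k + 1) (fun x => L x * f x) :=
  ⟨L.contDiff.mul hf.1, fun n => (hf.2 n).linear_mul le_rfl L hf.1⟩

/-- If `1 + h` has no zeros and `h` decays, so does `(1 + h)⁻¹ - 1`. -/
lemma Decays.one_add_inv {k : ℝ} (hk : k ≤ 0) {h : V → ℝ} (hh : Decays k h)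
    (h0 : ∀ x, 1 + h x ≠ 0) : Decays k (fun x => (1 + h x)⁻¹ - 1) := by
  have hs : ContDiff ℝ ∞ (fun x => (1 + h x)⁻¹ - 1) :=
    ((contDiff_const.add hh.1).inv h0).sub contDiff_const
  refine ⟨hs, fun n => ?_⟩
  have hz : (fun x => (1 + h x)⁻¹ - 1) =o[cobounded V] fun x => ‖x‖ ^ k := by
    have hb : (fun x => (1 + h x)⁻¹) =O[cobounded V] fun _ => (1 : ℝ) := by
      have h1 : Tendsto h (cobounded V) (𝓝 0) := by
        have h2 : (fun x : V => ‖x‖ ^ k) =O[cobounded V] fun _ => (1 : ℝ) := by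
          refine IsBigO.of_bound 1 ?_
          filter_upwards [eventually_one_le_norm] with x hx
          rw [Real.norm_of_nonneg (by positivity)]
          simpa using Real.rpow_le_one_of_one_le_of_nonpos hx hk
        exact (isLittleO_one_iff ℝ).1 (hh.isLittleO.trans_isBigO h2)
      have h3 : Tendsto (fun x => (1 + h x)⁻¹) (cobounded V) (𝓝 (1 + 0)⁻¹) :=
        (tendsto_const_nhds.add h1).inv₀ (by norm_num)
      exact h3.isBigO_one ℝ
    have := hb.mul_isLittleO hh.neg.isLittleO
    simp only [one_mul] at this
    refine this.congr (fun x => ?_) fun _ => rfl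
    have := h0 x
    field_simp
    ring
  induction n with
  | zero => exact hz
  | succ n ih =>
    refine ⟨hz, fun v => ?_⟩
    -- With `g = (1 + h)⁻¹ - 1` one has `(1 + h)⁻² = 1 + 2g + g²`, so the derivative is a polynomial
    -- in `∂h` and `g` and the induction closes.
    have hd : AxiGauge.dirD v (fun x => (1 + h x)⁻¹ - 1) = fun x =>
        -(AxiGauge.dirD v h x + 2 * (AxiGauge.dirD v h x * ((1 + h x)⁻¹ - 1)) +
          AxiGauge.dirD v h x * ((1 + h x)⁻¹ - 1) * ((1 + h x)⁻¹ - 1)) := by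
      ext x
      have e1 : HasFDerivAt (fun x => 1 + h x) (fderiv ℝ h x) x :=
        (hh.1.differentiable_infty x).hasFDerivAt.const_add 1
      have e2 := ((hasDerivAt_inv (h0 x)).comp_hasFDerivAt x e1).sub_const 1
      simp only [AxiGauge.dirD]
      rw [HasFDerivAt.fderiv (f := fun x => (1 + h x)⁻¹ - 1) e2]
      simp [← inv_pow]
      ring
    rw [hd]
    set g := fun x => (1 + h x)⁻¹ - 1 with hg
    have hl := le_refl (cobounded V)
    have d1 : DecaysN (cobounded V) n (k - 1) (AxiGauge.dirD v h) := (hh.dirD v).2 n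
    have c1 := contDiff_dirD hh.1 v
    have d2 := (d1.mul hl c1 hs ih)
    have d3 := (d2.mul hl (c1.mul hs) hs ih).mono (k' := k - 1) hl (by linarith)
    replace d2 := d2.mono (k' := k - 1) hl (by linarith)
    have d4 := DecaysN.clm_comp (ContinuousLinearMap.mul ℝ ℝ 2) (c1.mul hs) d2
    have c4 : ContDiff ℝ ∞ fun x => ContinuousLinearMap.mul ℝ ℝ 2 (AxiGauge.dirD v h x * g x) :=
      (ContinuousLinearMap.contDiff _).comp (c1.mul hs)
    have d5 := DecaysN.add (c1.add c4) ((c1.mul hs).mul hs) (d1.add c1 c4 d4) d3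
    simpa using DecaysN.clm_comp (-ContinuousLinearMap.id ℝ ℝ)
      ((c1.add c4).add ((c1.mul hs).mul hs)) d5

end Decay

/-! ### Coordinate multi-indices versus directional derivatives -/

section Coordinates

variable {n : ℕ}

lemma pd_eq_dirD (i : Fin n) (f : E n → ℝ) : pd i f = dirD (EuclideanSpace.single i 1) f := rfl

lemma dirD_eq_sum (v : E n) (f : E n → ℝ) : dirD v f = fun x => ∑ i, v i * pd i f x := by
  ext x
  have : v = ∑ i, v i • EuclideanSpace.single i (1 : ℝ) := by
    ext j; simp [Pi.single_apply]
  conv_lhs => rw [dirD, this]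
  simp [pd]

/-- The last index of the list acts first. `DecaysN` also peels off the innermost derivative, hence
the inductions from the end of the list. -/
lemma pdList_snoc (I : List (Fin n)) (i : Fin n) (f : E n → ℝ) :
    pdList (I ++ [i]) f = pdList I (pd i f) := by
  simp [pdList]

lemma IsLittleOInfty.pd {k : ℝ} {f : E n → ℝ} (h : IsLittleOInfty k f) (i : Fin n) :
    IsLittleOInfty (k - 1) (pd i f) := by
  intro I
  have := h (I ++ [i])
  rw [pdList_snoc] at this
  refine this.congr (fun _ => rfl) fun x => ?_
  congr 1
  push_cast [List.length_append, List.length_singleton]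
  ring

lemma DecaysN.sum {ι V W : Type*} [NormedAddCommGroup V] [NormedSpace ℝ V] [NormedAddCommGroup W]
    [NormedSpace ℝ W] {l : Filter V} {m : ℕ} {k : ℝ} (s : Finset ι) {f : ι → V → W}
    (hf : ∀ i, ContDiff ℝ ∞ (f i)) (h : ∀ i, DecaysN l m k (f i)) :
    DecaysN l m k (fun x => ∑ i ∈ s, f i x) := by
  classical
  induction s using Finset.induction_on with
  | empty =>
    simp only [Finset.sum_empty]
    have : ∀ m k, DecaysN l m k (fun _ : V => (0 : W)) := by
      intro m
      induction m with
      | zero => exact fun k => isLittleO_zero _ _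
      | succ m ih =>
        refine fun k => ⟨isLittleO_zero _ _, fun v => ?_⟩
        have : dirD v (fun _ : V => (0 : W)) = fun _ => 0 := by ext; simp [dirD]
        rw [this]; exact ih _
    exact this m k
  | insert a s ha ih =>
    simp only [Finset.sum_insert ha]
    exact (h a).add (hf a) (ContDiff.sum fun i _ => hf i) ih

lemma IsLittleOInfty.decays {k : ℝ} {f : E n → ℝ} (h : IsLittleOInfty k f)
    (hf : ContDiff ℝ ∞ f) : Decays k f := by
  refine ⟨hf, fun m => ?_⟩
  induction m generalizing k f with
  | zero => exact (by simpa [pdList] using h [] : f =o[cobounded (E n)] fun x => ‖x‖ ^ k)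
  | succ m ih =>
    refine ⟨by simpa [pdList] using h [], fun v => ?_⟩
    rw [dirD_eq_sum]
    refine DecaysN.sum _ (fun i => contDiff_const.mul (contDiff_dirD hf _)) fun i => ?_
    exact DecaysN.clm_comp (ContinuousLinearMap.mul ℝ ℝ (v i)) (contDiff_dirD hf _)
      (ih (h.pd i) (contDiff_dirD hf _))

lemma Decays.isLittleOInfty {k : ℝ} {f : E n → ℝ} (h : Decays k f) : IsLittleOInfty k f := by
  intro I
  induction I using List.reverseRecOn generalizing k f with
  | nil => simpa [pdList] using h.isLittleO
  | append_singleton I i ih =>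
    rw [pdList_snoc]
    refine (ih (h.dirD (EuclideanSpace.single i 1))).congr (fun _ => rfl) fun x => ?_
    congr 1
    push_cast [List.length_append, List.length_singleton]
    ring

end Coordinates

end AxiGauge

namespace AxiGauge

open Filter Asymptotics Bornology MeasureTheory
open scoped Topology

/-! ### Bounds and integrability of decaying functions -/

section Bounds

/-- The function `(1 + r)^k`. -/
noncomputable def bracket {V : Type*} [Norm V] (k : ℝ) (x : V) : ℝ := (1 + ‖x‖) ^ k

lemma bracket_pos {V : Type*} [SeminormedAddCommGroup V] (k : ℝ) (x : V) : 0 < bracket k x := by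
  unfold bracket; positivity

lemma continuous_bracket {V : Type*} [SeminormedAddCommGroup V] (k : ℝ) :
    Continuous (bracket k : V → ℝ) := by
  unfold bracket
  exact (continuous_const.add continuous_norm).rpow_const fun x =>
    Or.inl (by linarith [norm_nonneg x] : (0 : ℝ) < 1 + ‖x‖).ne'

lemma exists_bound_bracket {V W : Type*} [NormedAddCommGroup V] [ProperSpace V]
    [NormedAddCommGroup W] {k : ℝ} (hk : k ≤ 0) {f : V → W} (hf : Continuous f)
    (h : f =o[cobounded V] fun x => ‖x‖ ^ k) : ∃ M, 0 ≤ M ∧ ∀ x, ‖f x‖ ≤ M * bracket k x := by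
  have h1 := h.bound one_pos
  have h2 := h1.and (eventually_one_le_norm (V := V))
  rw [Metric.cobounded_eq_cocompact, eventually_iff, mem_cocompact] at h2
  obtain ⟨t, ht, hts⟩ := h2
  obtain ⟨C, hC⟩ := ht.exists_bound_of_continuousOn
    (f := fun x => ‖f x‖ / bracket k x)
    (hf.norm.div (continuous_bracket k) fun x => (bracket_pos k x).ne').continuousOn
  -- `C` serves on the compact set. Off it `‖x‖ ≥ 1`, so `(1 + ‖x‖) / 2 ≤ ‖x‖`, and the power `k ≤
  -- 0` costs the factor `2 ^ (-k)`.
  refine ⟨max (max C 0) (2 ^ (-k)), by positivity, fun x => ?_⟩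
  by_cases hx : x ∈ t
  · have := (le_abs_self _).trans (hC x hx)
    rw [div_le_iff₀ (bracket_pos k x)] at this
    refine this.trans ?_
    have := (bracket_pos k x).le
    gcongr
    exact (le_max_left C 0).trans (le_max_left _ _)
  · obtain ⟨h3, h4⟩ := hts hx
    rw [one_mul, Real.norm_of_nonneg (by positivity)] at h3
    refine h3.trans ?_
    have : ‖x‖ ^ k ≤ ((1 + ‖x‖) / 2) ^ k :=
      Real.rpow_le_rpow_of_nonpos (by positivity) (by linarith) hk
    refine this.trans ?_
    rw [Real.div_rpow (by positivity) (by positivity), div_eq_mul_inv,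
      ← Real.rpow_neg (by norm_num), mul_comm]
    have := (bracket_pos k x).le
    gcongr
    · exact le_max_right _ _
    · exact le_rfl

/-- Peetre's inequality: `1 + ‖w‖ ≤ (1 + ‖z‖)(1 + ‖z - w‖)`. It bounds a decaying function of `z -
w` by one of `w`, locally uniformly in `z`. -/
lemma bracket_sub_le {V : Type*} [SeminormedAddCommGroup V] {k : ℝ} (hk : k ≤ 0) (z w : V) :
    bracket k (z - w) ≤ bracket (-k) z * bracket k w := by
  unfold bracket
  have h : (1 + ‖w‖) / (1 + ‖z‖) ≤ 1 + ‖z - w‖ := by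
    rw [div_le_iff₀ (by positivity)]
    have h1 := norm_sub_rev z w
    have h2 : ‖w‖ ≤ ‖w - z‖ + ‖z‖ := by simpa using norm_add_le (w - z) z
    nlinarith [norm_nonneg z, norm_nonneg (z - w)]
  refine (Real.rpow_le_rpow_of_nonpos (by positivity) h hk).trans ?_
  rw [Real.div_rpow (by positivity) (by positivity), Real.rpow_neg (by positivity),
    div_eq_inv_mul]

/-- In polar coordinates the integrand is at most `y^(1-s)` near the origin and `y^(1-s-t)` near
infinity. -/
lemma integrable_radial {s t : ℝ} (hs : s < 2) (hst : 2 < s + t) (_ht : 0 ≤ t) :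
    Integrable fun w : ℂ => ‖w‖ ^ (-s) * bracket (-t) w := by
  have key := integrable_fun_norm_addHaar (volume : Measure ℂ)
    (f := fun y : ℝ => y ^ (-s) * (1 + y) ^ (-t))
  refine (key.2 ?_)
  rw [Complex.finrank_real_complex, ← Set.Ioc_union_Ioi_eq_Ioi zero_le_one]
  have hm : Measurable fun y : ℝ => y ^ (2 - 1) • (y ^ (-s) * (1 + y) ^ (-t)) := by
    fun_prop
  refine IntegrableOn.union ?_ ?_
  · have h1 : IntegrableOn (fun y : ℝ => y ^ (1 - s)) (Set.Ioc 0 1) := by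
      rw [← intervalIntegrable_iff_integrableOn_Ioc_of_le zero_le_one]
      exact intervalIntegral.intervalIntegrable_rpow' (by linarith)
    refine h1.mono' hm.aestronglyMeasurable ?_
    refine (ae_restrict_iff' measurableSet_Ioc).2 (ae_of_all _ fun y hy => ?_)
    have hy0 : 0 < y := hy.1
    rw [Real.norm_of_nonneg (by positivity), smul_eq_mul, ← mul_assoc, sub_eq_add_neg,
      Real.rpow_add hy0]
    simp only [Nat.add_one_sub_one, pow_one, Real.rpow_one]
    exact mul_le_of_le_one_right (by positivity)
      (Real.rpow_le_one_of_one_le_of_nonpos (by linarith) (by linarith))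
  · have h1 : IntegrableOn (fun y : ℝ => y ^ (1 - s - t)) (Set.Ioi 1) :=
      integrableOn_Ioi_rpow_of_lt (by linarith) one_pos
    refine h1.mono' hm.aestronglyMeasurable ?_
    refine (ae_restrict_iff' measurableSet_Ioi).2 (ae_of_all _ fun y hy => ?_)
    have hy1 : 1 < y := hy
    have hy0 : 0 < y := by linarith
    rw [Real.norm_of_nonneg (by positivity), smul_eq_mul, ← mul_assoc, sub_eq_add_neg,
      Real.rpow_add hy0, sub_eq_add_neg, Real.rpow_add hy0]
    simp only [Nat.add_one_sub_one, pow_one, Real.rpow_one]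
    have := Real.rpow_le_rpow_of_nonpos hy0 (show y ≤ 1 + y by linarith) (show -t ≤ 0 by linarith)
    gcongr

lemma ae_ne_zero : ∀ᵐ w : ℂ, w ≠ 0 := by
  simp [ae_iff]

/-- The potential of `‖w‖^(-s)` in the plane. -/
lemma exists_potential_bound {s : ℝ} (h1 : 1 < s) (h2 : s < 2) : ∃ C, 0 ≤ C ∧ ∀ z : ℂ, z ≠ 0 →
    Integrable (fun w : ℂ => ‖w‖ ^ (-s) * ‖z - w‖⁻¹) ∧
      ∫ w : ℂ, ‖w‖ ^ (-s) * ‖z - w‖⁻¹ ≤ C * ‖z‖ ^ (1 - s) := by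
  -- After rescaling by `r = ‖z‖`, the profile `Φ` dominates where `w` is nearer to `0` than to `z`,
  -- and `Ψ`, centred at `z`, where it is nearer to `z`. Scaling gives `r^(-s-1) · r² = r^(1-s)`.
  set Φ : ℂ → ℝ := fun w => ‖w‖ ^ (-s) * bracket (-1) w with hΦ
  set Ψ : ℂ → ℝ := fun w => ‖w‖ ^ (-1 : ℝ) * bracket (-s) w with hΨ
  have iΦ : Integrable Φ := integrable_radial h2 (by linarith) zero_le_one
  have iΨ : Integrable Ψ := integrable_radial one_lt_two (by linarith) (by linarith)
  have pΦ : ∀ w, 0 ≤ Φ w := fun w => mul_nonneg (by positivity) (bracket_pos _ _).le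
  have pΨ : ∀ w, 0 ≤ Ψ w := fun w => mul_nonneg (by positivity) (bracket_pos _ _).le
  refine ⟨9 * ((∫ w, Φ w) + ∫ w, Ψ w),
    mul_nonneg (by norm_num) (add_nonneg (integral_nonneg pΦ) (integral_nonneg pΨ)),
    fun z hz => ?_⟩
  set r := ‖z‖ with hr
  have r0 : 0 < r := norm_pos_iff.2 hz
  set g : ℂ → ℝ := fun w => 9 * r ^ (-s - 1) * (Φ (r⁻¹ • w) + Ψ (r⁻¹ • (z - w))) with hg
  have jΦ : Integrable (fun w => Φ (r⁻¹ • w)) := iΦ.comp_smul (inv_ne_zero r0.ne')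
  have jΨ : Integrable (fun w => Ψ (r⁻¹ • w)) := iΨ.comp_smul (inv_ne_zero r0.ne')
  have jΨ' : Integrable (fun w => Ψ (r⁻¹ • (z - w))) := jΨ.comp_sub_left z
  have ig : Integrable g := (jΦ.add jΨ').const_mul _
  have hle : ∀ w, ‖w‖ ^ (-s) * ‖z - w‖⁻¹ ≤ g w := by
    intro w
    have g0 : 0 ≤ g w := mul_nonneg (by positivity) (add_nonneg (pΦ _) (pΨ _))
    -- At the singular points `w = 0` and `w = z` the left side is `0` by the conventions `0 ^ (-s)
    -- = 0` and `0⁻¹ = 0`.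
    rcases (norm_nonneg w).eq_or_lt with ha | ha
    · rw [← ha, Real.zero_rpow (by linarith), zero_mul]; exact g0
    rcases (norm_nonneg (z - w)).eq_or_lt with hb | hb
    · rw [← hb, inv_zero, mul_zero]; exact g0
    have hab : r ≤ ‖w‖ + ‖z - w‖ := by simpa using norm_add_le w (z - w)
    have eΦ : r ^ (-s - 1) * Φ (r⁻¹ • w) = ‖w‖ ^ (-s) * (r + ‖w‖)⁻¹ := by
      simp only [hΦ, bracket, norm_smul, norm_inv, Real.norm_of_nonneg r0.le]
      rw [Real.mul_rpow (by positivity) (by positivity), Real.inv_rpow r0.le,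
        Real.rpow_neg r0.le s, inv_inv, Real.rpow_neg_one, sub_eq_add_neg, Real.rpow_add r0,
        Real.rpow_neg_one, Real.rpow_neg r0.le]
      have : r ^ s ≠ 0 := by positivity
      field_simp
    have eΨ : r ^ (-s - 1) * Ψ (r⁻¹ • (z - w)) = ‖z - w‖⁻¹ * (r + ‖z - w‖) ^ (-s) := by
      simp only [hΨ, bracket, norm_smul, norm_inv, Real.norm_of_nonneg r0.le]
      have : 1 + r⁻¹ * ‖z - w‖ = r⁻¹ * (r + ‖z - w‖) := by field_simp
      rw [this, Real.mul_rpow (by positivity) (by positivity), Real.inv_rpow r0.le,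
        Real.mul_rpow (by positivity) (by positivity), Real.inv_rpow r0.le, Real.rpow_neg r0.le s,
        inv_inv, Real.rpow_neg_one, Real.rpow_neg_one, sub_eq_add_neg (-s), Real.rpow_add r0,
        Real.rpow_neg_one, Real.rpow_neg r0.le]
      have : r ^ s ≠ 0 := by positivity
      field_simp
    have eg : g w = 9 * (‖w‖ ^ (-s) * (r + ‖w‖)⁻¹) + 9 * (‖z - w‖⁻¹ * (r + ‖z - w‖) ^ (-s)) := by
      rw [← eΦ, ← eΨ]; simp only [hg]; ring
    rw [eg]
    -- The triangle inequality gives `r + ‖w‖ ≤ 3 ‖z - w‖` in the first case and `r + ‖z - w‖ ≤ 3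
    -- ‖w‖` in the second. The constant `9` covers both, since `3 ^ s ≤ 9` for `s < 2`.
    rcases le_total ‖w‖ ‖z - w‖ with h | h
    · have : ‖z - w‖⁻¹ ≤ 9 * (r + ‖w‖)⁻¹ := by
        rw [← div_eq_mul_inv, inv_eq_one_div, div_le_div_iff₀ hb (by positivity)]
        linarith
      have h3 : ‖w‖ ^ (-s) * ‖z - w‖⁻¹ ≤ ‖w‖ ^ (-s) * (9 * (r + ‖w‖)⁻¹) := by gcongr
      have h4 : 0 ≤ 9 * (‖z - w‖⁻¹ * (r + ‖z - w‖) ^ (-s)) := by positivity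
      linarith
    · have h5 : ‖w‖ ^ (-s) ≤ 9 * (r + ‖z - w‖) ^ (-s) := by
        have : (r + ‖z - w‖) / 3 ≤ ‖w‖ := by linarith
        refine (Real.rpow_le_rpow_of_nonpos (by positivity) this (by linarith)).trans ?_
        rw [Real.div_rpow (by positivity) (by norm_num), div_eq_inv_mul,
          ← Real.rpow_neg (by norm_num), neg_neg]
        gcongr
        calc (3 : ℝ) ^ s ≤ 3 ^ (2 : ℝ) :=
              Real.rpow_le_rpow_of_exponent_le (by norm_num) h2.le
          _ = 9 := by norm_num
      have h3 : ‖w‖ ^ (-s) * ‖z - w‖⁻¹ ≤ 9 * (r + ‖z - w‖) ^ (-s) * ‖z - w‖⁻¹ := by gcongr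
      have h4 : 0 ≤ 9 * (‖w‖ ^ (-s) * (r + ‖w‖)⁻¹) := by positivity
      linarith
  have hint : Integrable (fun w : ℂ => ‖w‖ ^ (-s) * ‖z - w‖⁻¹) := by
    refine ig.mono' (by fun_prop) (ae_of_all _ fun w => ?_)
    rw [Real.norm_of_nonneg (by positivity)]
    exact hle w
  refine ⟨hint, (integral_mono hint ig hle).trans_eq ?_⟩
  simp only [hg]
  rw [integral_const_mul, integral_add jΦ jΨ',
    integral_sub_left_eq_self (fun w => Ψ (r⁻¹ • w)) volume z,
    Measure.integral_comp_inv_smul_of_nonneg _ _ r0.le,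
    Measure.integral_comp_inv_smul_of_nonneg _ _ r0.le, Complex.finrank_real_complex]
  have : r ^ (1 - s) = r ^ (-s - 1) * r ^ 2 := by
    rw [← Real.rpow_natCast r 2, ← Real.rpow_add r0]; congr 1; push_cast; ring
  rw [this, smul_eq_mul, smul_eq_mul]
  ring

end Bounds

end AxiGauge

namespace AxiGauge

open Filter Asymptotics Bornology MeasureTheory
open scoped Topology

/-! ### The Cauchy transform of the plane -/

section Cauchy

/-- The Cauchy transform `π⁻¹ ∫ F(w) / (z - w) dw`. -/
noncomputable def cauchy (F : ℂ → ℂ) (z : ℂ) : ℂ := (Real.pi : ℂ)⁻¹ * ∫ w, F (z - w) * w⁻¹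

lemma Decays.exists_bound {V W : Type*} [NormedAddCommGroup V] [NormedSpace ℝ V] [ProperSpace V]
    [NormedAddCommGroup W] [NormedSpace ℝ W] {k : ℝ} (hk : k ≤ 0) {f : V → W} (h : Decays k f) :
    ∃ M, 0 ≤ M ∧ ∀ x, ‖f x‖ ≤ M * bracket k x :=
  exists_bound_bracket hk h.1.continuous h.isLittleO

lemma norm_clm_complex_le (L : ℂ →L[ℝ] ℂ) : ‖L‖ ≤ ‖L 1‖ + ‖L Complex.I‖ := by
  refine L.opNorm_le_bound (by positivity) fun z => ?_
  have : L z = z.re • L 1 + z.im • L Complex.I := by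
    rw [← map_smul, ← map_smul, ← map_add]; congr 1; simp [Complex.re_add_im]
  rw [this]
  refine (norm_add_le _ _).trans ?_
  rw [norm_smul, norm_smul, add_mul, mul_comm ‖L 1‖, mul_comm ‖L Complex.I‖]
  gcongr
  · exact Complex.abs_re_le_norm z
  · exact Complex.abs_im_le_norm z

lemma Decays.exists_fderiv_bound {k : ℝ} (hk : k ≤ 0) {F : ℂ → ℂ} (h : Decays k F) :
    ∃ M, 0 ≤ M ∧ ∀ x, ‖fderiv ℝ F x‖ ≤ M * bracket (k - 1) x := by
  obtain ⟨M, hM, h1⟩ := (h.dirD 1).exists_bound (by linarith)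
  obtain ⟨N, hN, h2⟩ := (h.dirD Complex.I).exists_bound (by linarith)
  refine ⟨M + N, by positivity, fun x => (norm_clm_complex_le _).trans ?_⟩
  rw [add_mul]
  exact add_le_add (h1 x) (h2 x)

lemma bracket_mono {V : Type*} [SeminormedAddCommGroup V] {k m : ℝ} (h : k ≤ m) (x : V) :
    bracket k x ≤ bracket m x :=
  Real.rpow_le_rpow_of_exponent_le (by linarith [norm_nonneg x]) h

lemma integrable_bracket_div : Integrable fun w : ℂ => bracket (-3 / 2) w * ‖w‖⁻¹ := by
  have := integrable_radial (s := 1) (t := 3 / 2) (by norm_num) (by norm_num) (by norm_num)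
  refine this.congr (ae_of_all _ fun w => ?_)
  simp only [Real.rpow_neg_one]
  rw [mul_comm]; norm_num

lemma integrable_cauchy {F : ℂ → ℂ} (hF : Continuous F) {M : ℝ}
    (hM : ∀ x, ‖F x‖ ≤ M * bracket (-3 / 2) x) (z : ℂ) :
    Integrable fun w => F (z - w) * w⁻¹ := by
  have M0 : 0 ≤ M := by
    have := (norm_nonneg _).trans (hM 0)
    exact nonneg_of_mul_nonneg_left this (bracket_pos _ _)
  refine (integrable_bracket_div.const_mul (M * bracket (3 / 2) z)).mono' (by fun_prop)
    (ae_of_all _ fun w => ?_)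
  rw [norm_mul, norm_inv, ← mul_assoc, mul_assoc M]
  gcongr
  refine (hM _).trans ?_
  gcongr
  have := bracket_sub_le (k := -3 / 2) (by norm_num) z w
  rwa [show -(-3 / 2 : ℝ) = 3 / 2 by norm_num] at this

/-- In convolution form the derivative falls on `F` and never on the singular, locally integrable
kernel. Peetre's inequality dominates the integrand uniformly for base points within distance `1` of
`z`. -/
lemma hasFDerivAt_cauchy {F : ℂ → ℂ} (h : Decays (-3 / 2) F) (z : ℂ) :
    HasFDerivAt (cauchy F) ((Real.pi : ℂ)⁻¹ • ∫ w, w⁻¹ • fderiv ℝ F (z - w)) z ∧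
      Integrable (fun w => w⁻¹ • fderiv ℝ F (z - w)) := by
  obtain ⟨M, hM0, hM⟩ := h.exists_bound (by norm_num)
  obtain ⟨N, hN0, hN⟩ := h.exists_fderiv_bound (by norm_num)
  have hc : Continuous (fderiv ℝ F) := (h.1.fderiv_right (m := ∞) (by simp)).continuous
  have hF := h.1.continuous
  set bd : ℂ → ℝ := fun w => (N * (2 + ‖z‖) ^ (3 / 2 : ℝ)) * (bracket (-3 / 2) w * ‖w‖⁻¹)
  have hbound : ∀ w, ∀ x ∈ Metric.ball z 1, ‖w⁻¹ • fderiv ℝ F (x - w)‖ ≤ bd w := by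
    intro w x hx
    rw [norm_smul, norm_inv, mul_comm]
    simp only [bd]
    rw [← mul_assoc]
    gcongr
    refine (hN _).trans ?_
    rw [mul_assoc]
    gcongr
    refine (bracket_mono (by norm_num : (-3 / 2 - 1 : ℝ) ≤ -3 / 2) _).trans ?_
    refine (bracket_sub_le (by norm_num) x w).trans ?_
    have hx1 : ‖x‖ ≤ 1 + ‖z‖ := by
      have := norm_le_norm_add_norm_sub' x z
      rw [mem_ball_iff_norm] at hx
      linarith
    have := (bracket_pos (-3 / 2) w).le
    gcongr
    unfold bracket
    rw [show -(-3 / 2 : ℝ) = 3 / 2 by norm_num]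
    exact Real.rpow_le_rpow (by positivity) (by linarith) (by norm_num)
  have hmeas : AEStronglyMeasurable (fun w => w⁻¹ • fderiv ℝ F (z - w)) :=
    measurable_inv.aestronglyMeasurable.smul (by fun_prop)
  have ibd : Integrable bd := integrable_bracket_div.const_mul _
  constructor
  · have := hasFDerivAt_integral_of_dominated_of_fderiv_le (𝕜 := ℝ) (μ := volume)
      (F := fun x w => F (x - w) * w⁻¹) (F' := fun x w => w⁻¹ • fderiv ℝ F (x - w))
      (bound := bd) (Metric.ball_mem_nhds z one_pos)
      (Eventually.of_forall fun x => (integrable_cauchy hF hM x).aestronglyMeasurable)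
      (integrable_cauchy hF hM z) hmeas (ae_of_all _ hbound) ibd
      (ae_of_all _ fun w x _ => by
        have h1 : HasFDerivAt (fun x => F (x - w)) (fderiv ℝ F (x - w)) x := by
          have := (h.1.differentiable_infty (x - w)).hasFDerivAt.comp x
            ((hasFDerivAt_id x).sub_const w)
          simpa only [Function.comp_def, id, ContinuousLinearMap.comp_id] using this
        exact h1.mul_const w⁻¹)
    exact this.const_mul _
  · exact ibd.mono' hmeas (ae_of_all _ fun w => hbound w z (Metric.mem_ball_self one_pos))

lemma dirD_cauchy {F : ℂ → ℂ} (h : Decays (-3 / 2) F) (v : ℂ) :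
    dirD v (cauchy F) = cauchy (dirD v F) := by
  ext z
  obtain ⟨h1, h2⟩ := hasFDerivAt_cauchy h z
  rw [dirD, h1.fderiv, cauchy]
  simp only [smul_apply, smul_eq_mul]
  rw [ContinuousLinearMap.integral_apply h2]
  simp [dirD, mul_comm]

/-- Discarding the order gained by differentiation keeps derivatives in the weight class `-3/2` that
the lemmas on the transform assume. -/
lemma Decays.dirD' {V W : Type*} [NormedAddCommGroup V] [NormedSpace ℝ V]
    [NormedAddCommGroup W] [NormedSpace ℝ W] {k : ℝ} {f : V → W} (h : Decays k f) (v : V) :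
    Decays k (AxiGauge.dirD v f) := (h.dirD v).mono (by linarith)

lemma contDiff_cauchy {F : ℂ → ℂ} (h : Decays (-3 / 2) F) : ContDiff ℝ ∞ (cauchy F) := by
  have key : ∀ n : ℕ, ∀ F : ℂ → ℂ, Decays (-3 / 2) F → ContDiff ℝ n (cauchy F) := by
    intro n
    induction n with
    | zero =>
      intro F h
      have : Differentiable ℝ (cauchy F) := fun z => (hasFDerivAt_cauchy h z).1.differentiableAt
      exact contDiff_zero.2 this.continuous
    | succ n ih =>
      intro F h
      rw [Nat.cast_succ]
      refine contDiff_succ_iff_fderiv_apply.2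
        ⟨fun z => (hasFDerivAt_cauchy h z).1.differentiableAt,
          fun hn => absurd hn (WithTop.natCast_ne_top n), fun v => ?_⟩
      have := dirD_cauchy h v
      unfold dirD at this
      rw [this]
      exact ih _ (h.dirD' v)
  exact contDiff_infty.2 fun n => key n F h

/-- The potential estimate alone gives only `O(r^{-1/2})`. For little-o, `F` is bounded by an
arbitrarily small multiple of `‖w‖^(-3/2)` plus a large multiple of a faster decaying power, which
absorbs the bounded region. -/
lemma cauchy_isLittleO {F : ℂ → ℂ} (hF : Continuous F)
    (h : F =o[cobounded ℂ] fun x => ‖x‖ ^ (-3 / 2 : ℝ)) :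
    cauchy F =o[cobounded ℂ] fun x => ‖x‖ ^ (-1 / 2 : ℝ) := by
  obtain ⟨M, hM0, hM⟩ := exists_bound_bracket (by norm_num) hF h
  obtain ⟨C₁, hC₁, h₁⟩ := exists_potential_bound (s := 3 / 2) (by norm_num) (by norm_num)
  -- Any exponent strictly between `3/2` and `2` would do: above `3/2` to decay faster, below `2` to
  -- stay integrable at the origin.
  obtain ⟨C₂, hC₂, h₂⟩ := exists_potential_bound (s := 7 / 4) (by norm_num) (by norm_num)
  have split : ∀ c : ℝ, 0 < c → ∃ N, 0 ≤ N ∧ ∀ w : ℂ, w ≠ 0 →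
      ‖F w‖ ≤ c * ‖w‖ ^ (-(3 / 2) : ℝ) + N * ‖w‖ ^ (-(7 / 4) : ℝ) := by
    intro c hc
    have hb := h.bound hc
    rw [(Metric.hasBasis_cobounded_compl_closedBall (0 : ℂ)).eventually_iff] at hb
    obtain ⟨R, -, hR⟩ := hb
    refine ⟨M * |R| ^ (7 / 4 : ℝ), by positivity, fun w hw => ?_⟩
    have hw0 : 0 < ‖w‖ := norm_pos_iff.2 hw
    by_cases hwR : ‖w‖ ≤ R
    · have h3 : ‖F w‖ ≤ M := by
        refine (hM w).trans (mul_le_of_le_one_right hM0 ?_)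
        exact Real.rpow_le_one_of_one_le_of_nonpos (by linarith) (by norm_num)
      have h4 : M ≤ M * |R| ^ (7 / 4 : ℝ) * ‖w‖ ^ (-(7 / 4) : ℝ) := by
        rw [Real.rpow_neg hw0.le, ← div_eq_mul_inv, mul_div_assoc]
        refine le_mul_of_one_le_right hM0 ?_
        rw [one_le_div (by positivity)]
        exact Real.rpow_le_rpow hw0.le (hwR.trans (le_abs_self R)) (by norm_num)
      have h5 : 0 ≤ c * ‖w‖ ^ (-(3 / 2) : ℝ) := by positivity
      linarith
    · have h3 := hR (x := w) (by simpa using hwR)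
      rw [Real.norm_of_nonneg (by positivity)] at h3
      rw [show (-(3 / 2) : ℝ) = -3 / 2 by norm_num]
      have h5 : 0 ≤ M * |R| ^ (7 / 4 : ℝ) * ‖w‖ ^ (-(7 / 4) : ℝ) := by positivity
      linarith
  have bound : ∀ c : ℝ, 0 < c → ∃ N, 0 ≤ N ∧ ∀ z : ℂ, z ≠ 0 →
      ‖cauchy F z‖ ≤ c * C₁ * ‖z‖ ^ (-1 / 2 : ℝ) + N * ‖z‖ ^ (-3 / 4 : ℝ) := by
    intro c hc
    obtain ⟨N, hN0, hN⟩ := split c hc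
    refine ⟨N * C₂, by positivity, fun z hz => ?_⟩
    have e : ∫ w, F (z - w) * w⁻¹ = ∫ w, F w * (z - w)⁻¹ := by
      rw [← integral_sub_left_eq_self (fun w => F w * (z - w)⁻¹) volume z]
      simp
    obtain ⟨i1, b1⟩ := h₁ z hz
    obtain ⟨i2, b2⟩ := h₂ z hz
    have hle : ‖∫ w, F w * (z - w)⁻¹‖ ≤ ∫ w : ℂ, (c * (‖w‖ ^ (-(3 / 2) : ℝ) * ‖z - w‖⁻¹) +
        N * (‖w‖ ^ (-(7 / 4) : ℝ) * ‖z - w‖⁻¹)) := by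
      refine norm_integral_le_of_norm_le ((i1.const_mul c).add (i2.const_mul N)) ?_
      filter_upwards [ae_ne_zero] with w hw
      rw [norm_mul, norm_inv, ← mul_assoc, ← mul_assoc, ← add_mul]
      gcongr
      exact hN w hw
    rw [integral_add (i1.const_mul c) (i2.const_mul N), integral_const_mul,
      integral_const_mul] at hle
    rw [cauchy, e, norm_mul, norm_inv, Complex.norm_real, Real.norm_of_nonneg Real.pi_pos.le]
    have hpi : Real.pi⁻¹ ≤ 1 := inv_le_one_of_one_le₀ (by linarith [Real.pi_gt_three])
    refine (mul_le_of_le_one_left (norm_nonneg _) hpi).trans (hle.trans ?_)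
    rw [mul_assoc c, mul_assoc N]
    rw [show (1 - 3 / 2 : ℝ) = -1 / 2 by norm_num] at b1
    rw [show (1 - 7 / 4 : ℝ) = -3 / 4 by norm_num] at b2
    gcongr
  refine IsLittleO.of_bound fun ε hε => ?_
  obtain ⟨N, hN0, hN⟩ := bound (ε / 2 / (C₁ + 1)) (by positivity)
  have hsmall : ∀ᶠ z : ℂ in cobounded ℂ, N * ‖z‖ ^ (-(1 / 4) : ℝ) ≤ ε / 2 := by
    have : Tendsto (fun z : ℂ => N * ‖z‖ ^ (-(1 / 4) : ℝ)) (cobounded ℂ) (𝓝 (N * 0)) :=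
      ((tendsto_rpow_neg_atTop (by norm_num)).comp tendsto_norm_cobounded_atTop).const_mul N
    rw [mul_zero] at this
    exact this.eventually (ge_mem_nhds (by positivity))
  filter_upwards [hsmall, eventually_one_le_norm] with z hz hz1
  have hz0 : 0 < ‖z‖ := by linarith
  rw [Real.norm_of_nonneg (by positivity)]
  refine (hN z (norm_pos_iff.1 hz0)).trans ?_
  have e : ‖z‖ ^ (-3 / 4 : ℝ) = ‖z‖ ^ (-(1 / 4) : ℝ) * ‖z‖ ^ (-1 / 2 : ℝ) := by
    rw [← Real.rpow_add hz0]; norm_num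
  rw [e, ← mul_assoc, ← add_mul]
  gcongr
  have : ε / 2 / (C₁ + 1) * C₁ ≤ ε / 2 := by
    rw [div_mul_eq_mul_div, div_le_iff₀ (by positivity)]
    nlinarith
  linarith

end Cauchy

end AxiGauge

namespace AxiGauge

open Filter Asymptotics Bornology MeasureTheory
open scoped Topology

/-! ### The Cauchy–Pompeiu formula and integrals of derivatives -/

section Pompeiu

open Complex in
/-- The Cauchy–Pompeiu formula for functions on the whole plane. -/
lemma integral_dbar_div {F : ℂ → ℂ} (hF : ContDiff ℝ ∞ F) {M : ℝ}
    (hM : ∀ w, ‖fderiv ℝ F w‖ ≤ M * bracket (-3 / 2) w) (h0 : Tendsto F (cobounded ℂ) (𝓝 0)) :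
    ∫ w, (dirD 1 F w + I * dirD I F w) * w⁻¹ = -(2 * Real.pi * F 0) := by
  set e : ℝ → ℂ := fun θ => Real.cos θ + Real.sin θ * I with he
  have ne : ∀ θ, ‖e θ‖ = 1 := by
    intro θ
    simp only [he, ofReal_cos, ofReal_sin]
    rw [← Complex.exp_mul_I, Complex.norm_exp_ofReal_mul_I]
  have ce : Continuous e := by fun_prop
  have de : ∀ θ, HasDerivAt e (I * e θ) θ := by
    intro θ
    have := (Real.hasDerivAt_cos θ).ofReal_comp.add ((Real.hasDerivAt_sin θ).ofReal_comp.mul_const I)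
    refine this.congr_deriv ?_
    simp only [he]
    push_cast
    linear_combination -(sin (θ : ℂ)) * I_mul_I
  have rl : ∀ (L : ℂ →L[ℝ] ℂ) (a : ℝ) (v : ℂ), L (a * v) = a * L v := by
    intro L a v
    simpa only [real_smul] using L.map_smul a v
  have cF' : Continuous (fderiv ℝ F) := (hF.fderiv_right (m := ∞) (by simp)).continuous
  -- In polar coordinates `e^{-iθ}(∂_x + i ∂_y) = ∂_r + (i/r) ∂_θ`, and the area factor `r` cancels
  -- the modulus of `w⁻¹`. Here `g₁ = ∂_r F` and `g₂ = r⁻¹ ∂_θ F`, both dominated by a function of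
  -- `r` integrable on the half-line.
  set g₁ : ℝ × ℝ → ℂ := fun p => fderiv ℝ F (p.1 * e p.2) (e p.2) with hg₁
  set g₂ : ℝ × ℝ → ℂ := fun p => fderiv ℝ F (p.1 * e p.2) (I * e p.2) with hg₂
  have cg₁ : Continuous g₁ := by
    refine (cF'.comp ?_).clm_apply (ce.comp continuous_snd)
    fun_prop
  have cg₂ : Continuous g₂ := by
    refine (cF'.comp ?_).clm_apply (continuous_const.mul (ce.comp continuous_snd))
    fun_prop
  set b : ℝ → ℝ := fun r => M * bracket (-3 / 2) r with hb
  have ib : IntegrableOn b (Set.Ioi 0) := by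
    have := integrable_one_add_norm (E := ℝ) (μ := volume) (r := 3 / 2) (by norm_num)
    have h2 := (this.const_mul M).integrableOn (s := Set.Ioi 0)
    refine h2.congr (ae_of_all _ fun r => ?_)
    simp only [hb, bracket]; norm_num
  have bg : ∀ (r θ : ℝ) (v : ℂ), ‖v‖ = 1 → ‖fderiv ℝ F (r * e θ) v‖ ≤ b r := by
    intro r θ v hv
    refine (ContinuousLinearMap.le_opNorm _ _).trans ?_
    rw [hv, mul_one]
    refine (hM _).trans_eq ?_
    simp only [hb, bracket, norm_mul, ne, mul_one, norm_real]
  have bg₁ : ∀ r θ, ‖g₁ (r, θ)‖ ≤ b r := fun r θ => bg r θ _ (ne θ)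
  have bg₂ : ∀ r θ, ‖g₂ (r, θ)‖ ≤ b r := fun r θ => bg r θ _ (by simp [ne])
  set S := Set.Ioi (0 : ℝ)
  set T := Set.Ioo (-Real.pi) Real.pi
  have hS : MeasurableSet S := measurableSet_Ioi
  have hT : MeasurableSet T := measurableSet_Ioo
  have hprod : (volume : Measure (ℝ × ℝ)).restrict (S ×ˢ T) =
      ((volume : Measure ℝ).restrict S).prod ((volume : Measure ℝ).restrict T) := by
    rw [Measure.prod_restrict]; rfl
  have hfin : IsFiniteMeasure ((volume : Measure ℝ).restrict T) :=
    ⟨by simp [T, Real.volume_Ioo]⟩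
  have ibp : Integrable (fun p : ℝ × ℝ => b p.1)
      (((volume : Measure ℝ).restrict S).prod ((volume : Measure ℝ).restrict T)) :=
    Integrable.comp_fst ib _
  have ig₁ : Integrable g₁ (((volume : Measure ℝ).restrict S).prod (volume.restrict T)) :=
    ibp.mono' cg₁.aestronglyMeasurable (ae_of_all _ fun p => bg₁ p.1 p.2)
  have ig₂ : Integrable g₂ (((volume : Measure ℝ).restrict S).prod (volume.restrict T)) :=
    ibp.mono' cg₂.aestronglyMeasurable (ae_of_all _ fun p => bg₂ p.1 p.2)
  have inner₁ : ∀ θ, ∫ r in S, g₁ (r, θ) = -F 0 := by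
    intro θ
    have hd : ∀ r ∈ Set.Ici (0 : ℝ), HasDerivAt (fun r : ℝ => F (r * e θ)) (g₁ (r, θ)) r := by
      intro r _
      have h1 : HasDerivAt (fun r : ℝ => (r : ℂ) * e θ) (e θ) r := by
        simpa using (hasDerivAt_id r).ofReal_comp.mul_const (e θ)
      exact (hF.differentiable_infty _).hasFDerivAt.comp_hasDerivAt r h1
    have hint : IntegrableOn (fun r => g₁ (r, θ)) (Set.Ioi 0) := by
      refine Integrable.mono' ib (cg₁.comp (by fun_prop)).aestronglyMeasurable
        (ae_of_all _ fun r => bg₁ r θ)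
    have ht : Tendsto (fun r : ℝ => F (r * e θ)) atTop (𝓝 0) := by
      refine h0.comp ?_
      rw [← tendsto_norm_atTop_iff_cobounded]
      simp only [norm_mul, ne, mul_one, norm_real]
      exact tendsto_norm_atTop_atTop
    have := integral_Ioi_of_hasDerivAt_of_tendsto' hd hint ht
    simpa using this
  have inner₂ : ∀ r ∈ S, ∫ θ in T, g₂ (r, θ) = 0 := by
    intro r hr
    have hr0 : (r : ℂ) ≠ 0 := by exact_mod_cast (ne_of_gt hr)
    have hd : ∀ θ ∈ Set.uIcc (-Real.pi) Real.pi,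
        HasDerivAt (fun θ : ℝ => F (r * e θ)) (r * g₂ (r, θ)) θ := by
      intro θ _
      have h2 := (hF.differentiable_infty _).hasFDerivAt.comp_hasDerivAt θ ((de θ).const_mul (r : ℂ))
      refine h2.congr_deriv ?_
      exact rl _ _ _
    have hc : Continuous fun θ => (r : ℂ) * g₂ (r, θ) :=
      continuous_const.mul (cg₂.comp (by fun_prop))
    have := intervalIntegral.integral_eq_sub_of_hasDerivAt hd (hc.intervalIntegrable _ _)
    have hz : e Real.pi = e (-Real.pi) := by simp [he]
    rw [hz, sub_self, intervalIntegral.integral_of_le (by linarith [Real.pi_pos]),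
      integral_Ioc_eq_integral_Ioo, integral_const_mul] at this
    exact (mul_eq_zero.1 this).resolve_left hr0
  rw [← Complex.integral_comp_polarCoord_symm]
  have hcongr : ∀ p ∈ polarCoord.target, p.1 • ((dirD 1 F (Complex.polarCoord.symm p) +
      I * dirD I F (Complex.polarCoord.symm p)) * (Complex.polarCoord.symm p)⁻¹) =
      g₁ p + I * g₂ p := by
    rintro ⟨r, θ⟩ hp
    have hr : (r : ℂ) ≠ 0 := by exact_mod_cast (ne_of_gt hp.1)
    have e1 : Complex.polarCoord.symm (r, θ) = r * e θ := by
      rw [Complex.polarCoord_symm_apply]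
    rw [e1]
    have lin : ∀ v : ℂ, fderiv ℝ F (r * e θ) v =
        v.re * dirD 1 F (r * e θ) + v.im * dirD I F (r * e θ) := by
      intro v
      simp only [dirD]
      rw [← rl, ← rl, ← map_add, mul_one, Complex.re_add_im]
    simp only [hg₁, hg₂]
    rw [lin (e θ), lin (I * e θ)]
    have r1 : (e θ).re = Real.cos θ := by simp [he, -ofReal_cos, -ofReal_sin]
    have r2 : (e θ).im = Real.sin θ := by simp [he, -ofReal_cos, -ofReal_sin]
    have hinv : (e θ)⁻¹ = Real.cos θ - Real.sin θ * I := by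
      refine inv_eq_of_mul_eq_one_right ?_
      simp only [he]
      have := Complex.cos_sq_add_sin_sq (θ : ℂ)
      push_cast
      linear_combination this - (sin (θ : ℂ)) ^ 2 * I_mul_I
    rw [mul_inv, hinv, real_smul]
    simp only [mul_re, mul_im, I_re, I_im, r1, r2]
    push_cast
    field_simp
    linear_combination (cos (θ : ℂ) * 0 - sin (θ : ℂ) * dirD I F (r * e θ)) * I_sq
  rw [setIntegral_congr_fun (by exact hS.prod hT) hcongr]
  change ∫ p in S ×ˢ T, g₁ p + I * g₂ p = _
  -- Fubini in opposite orders: `g₁` is integrated first in `r`, giving `-F 0`, and `g₂` first in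
  -- `θ`, giving `0` by periodicity.
  rw [hprod, integral_add ig₁ (ig₂.const_mul I), integral_const_mul, integral_prod_symm _ ig₁,
    integral_prod _ ig₂, setIntegral_congr_fun hS inner₂]
  simp only [inner₁]
  rw [setIntegral_const]
  have : (volume : Measure ℝ).real T = 2 * Real.pi := by
    simp only [T, Real.volume_real_Ioo]
    rw [max_eq_left (by linarith [Real.pi_pos])]; ring
  rw [this]
  simp

lemma Decays.tendsto_zero {V W : Type*} [NormedAddCommGroup V] [NormedSpace ℝ V]
    [NormedAddCommGroup W] [NormedSpace ℝ W] {k : ℝ} (hk : k < 0) {f : V → W} (h : Decays k f) :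
    Tendsto f (cobounded V) (𝓝 0) := by
  have h1 : Tendsto (fun x : V => ‖x‖ ^ k) (cobounded V) (𝓝 0) := by
    have := (tendsto_rpow_neg_atTop (y := -k) (by linarith)).comp
      (tendsto_norm_cobounded_atTop (E := V))
    simpa [Function.comp_def] using this
  exact h.isLittleO.isBigO.trans_tendsto h1

open Complex in
/-- The Cauchy transform inverts `∂_x + i ∂_y = 2 ∂/∂z̄`. -/
lemma dbar_cauchy {F : ℂ → ℂ} (h : Decays (-3 / 2) F) (z : ℂ) :
    dirD 1 (cauchy F) z + I * dirD I (cauchy F) z = 2 * F z := by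
  obtain ⟨N, hN0, hN⟩ := h.exists_fderiv_bound (by norm_num)
  rw [dirD_cauchy h, dirD_cauchy h]
  -- Recentring at `z` puts `F z` at the origin of the formula; the sign from the reflection of `w`
  -- cancels the sign there.
  set G : ℂ → ℂ := fun w => F (z - w)
  have hG : ContDiff ℝ ∞ G := h.1.comp (contDiff_const.sub contDiff_id)
  have hd : ∀ w, fderiv ℝ G w = -fderiv ℝ F (z - w) := by
    intro w
    have := (h.1.differentiable_infty (z - w)).hasFDerivAt.comp w ((hasFDerivAt_id w).const_sub z)
    rw [show G = F ∘ (HSub.hSub z) from rfl, this.fderiv]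
    ext; simp
  have key := integral_dbar_div hG (M := N * bracket (3 / 2) z) (fun w => by
    rw [hd, norm_neg]
    refine (hN _).trans ?_
    rw [mul_assoc]
    gcongr
    refine (bracket_mono (by norm_num : (-3 / 2 - 1 : ℝ) ≤ -3 / 2) _).trans ?_
    have := bracket_sub_le (k := -3 / 2) (by norm_num) z w
    rwa [show -(-3 / 2 : ℝ) = 3 / 2 by norm_num] at this) (by
    refine (h.tendsto_zero (by norm_num)).comp ?_
    exact tendsto_const_sub_cobounded z)
  have hG0 : G 0 = F z := by simp [G]
  rw [hG0] at key
  have e : ∀ v, dirD v G = fun w => -dirD v F (z - w) := by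
    intro v; ext w; simp only [dirD, hd]; rfl
  simp only [e] at key
  obtain ⟨M₁, -, hM₁⟩ := (h.dirD' 1).exists_bound (by norm_num)
  obtain ⟨M₂, -, hM₂⟩ := (h.dirD' I).exists_bound (by norm_num)
  have i1 := integrable_cauchy (h.dirD' 1).1.continuous hM₁ z
  have i2 := integrable_cauchy (h.dirD' I).1.continuous hM₂ z
  have key2 : ∫ w, (-dirD 1 F (z - w) + I * -dirD I F (z - w)) * w⁻¹ =
      -((∫ w, dirD 1 F (z - w) * w⁻¹) + I * ∫ w, dirD I F (z - w) * w⁻¹) := by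
    rw [← integral_const_mul, ← integral_add i1 (i2.const_mul I), ← integral_neg]
    congr 1; ext w; ring
  rw [key2] at key
  have hpi : (Real.pi : ℂ) ≠ 0 := by exact_mod_cast Real.pi_ne_zero
  simp only [cauchy]
  linear_combination -(Real.pi : ℂ)⁻¹ * key + 2 * F z * inv_mul_cancel₀ hpi

lemma Decays.integrable_of_lt {k : ℝ} (hk : k < -2) {F : ℂ → ℂ} (h : Decays k F) :
    Integrable F := by
  obtain ⟨M, -, hM⟩ := h.exists_bound (by linarith)
  have := integrable_one_add_norm (E := ℂ) (μ := volume) (r := -k) (by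
    rw [Complex.finrank_real_complex]; push_cast; linarith)
  simp only [neg_neg] at this
  exact (this.const_mul M).mono' h.1.continuous.aestronglyMeasurable (ae_of_all _ hM)

/-- The derivative decays like `r^{-5/2}`, hence is integrable on the plane, and on each horizontal
line it integrates to the difference of two vanishing limits. -/
lemma integral_dirD_one_eq_zero {F : ℂ → ℂ} (h : Decays (-3 / 2) F) : ∫ w, dirD 1 F w = 0 := by
  have hD := h.dirD 1
  have hi : Integrable (dirD 1 F) := hD.integrable_of_lt (by norm_num)
  have mp := Complex.volume_preserving_equiv_real_prod.symm
  rw [← mp.integral_comp Complex.measurableEquivRealProd.symm.measurableEmbedding]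
  have hi2 : Integrable (fun p : ℝ × ℝ => dirD 1 F (Complex.measurableEquivRealProd.symm p)) :=
    mp.integrable_comp_of_integrable hi
  rw [Measure.volume_eq_prod, integral_prod_symm _ hi2]
  refine integral_eq_zero_of_ae (ae_of_all _ fun y => ?_)
  simp only [Complex.measurableEquivRealProd_symm_apply, Pi.zero_apply]
  have hm : ∀ x : ℝ, (⟨x, y⟩ : ℂ) = x + y * Complex.I := fun x => Complex.mk_eq_add_mul_I x y
  have hd : ∀ x : ℝ, HasDerivAt (fun x : ℝ => F ⟨x, y⟩) (dirD 1 F ⟨x, y⟩) x := by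
    intro x
    have h1 : HasDerivAt (fun x : ℝ => (⟨x, y⟩ : ℂ)) 1 x := by
      simp only [hm]
      simpa using (hasDerivAt_id x).ofReal_comp.add_const ((y : ℂ) * Complex.I)
    exact (h.1.differentiable_infty _).hasFDerivAt.comp_hasDerivAt x h1
  have hcb : ∀ x : ℝ, ‖x‖ ≤ ‖(⟨x, y⟩ : ℂ)‖ := fun x => Complex.abs_re_le_norm ⟨x, y⟩
  have hint : Integrable fun x : ℝ => dirD 1 F ⟨x, y⟩ := by
    obtain ⟨M, hM0, hM⟩ := hD.exists_bound (by norm_num)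
    have := integrable_one_add_norm (E := ℝ) (μ := volume) (r := 5 / 2) (by norm_num)
    refine (this.const_mul M).mono' ?_ (ae_of_all _ fun x => (hM _).trans ?_)
    · simp only [hm]
      exact (hD.1.continuous.comp (by fun_prop)).aestronglyMeasurable
    · gcongr
      rw [bracket, show (-3 / 2 - 1 : ℝ) = -(5 / 2) by norm_num]
      exact Real.rpow_le_rpow_of_nonpos (by positivity) (by linarith [hcb x]) (by norm_num)
  have ht : ∀ l : Filter ℝ, Tendsto (fun x : ℝ => ‖x‖) l atTop →
      Tendsto (fun x : ℝ => F ⟨x, y⟩) l (𝓝 0) := by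
    intro l hl
    refine (h.tendsto_zero (by norm_num)).comp ?_
    rw [← tendsto_norm_atTop_iff_cobounded]
    exact tendsto_atTop_mono hcb hl
  have := integral_of_hasDerivAt_of_tendsto hd hint (ht _ tendsto_abs_atBot_atTop)
    (ht _ tendsto_norm_atTop_atTop)
  simpa using this

/-- A rotation, which preserves area and decay, carries the horizontal direction to `v`. -/
lemma integral_dirD_eq_zero {F : ℂ → ℂ} (h : Decays (-3 / 2) F) {v : ℂ} (hv : ‖v‖ = 1) :
    ∫ w, dirD v F w = 0 := by
  set c : Circle := ⟨v, by simpa [Submonoid.unitSphere] using hv⟩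
  have h1 := integral_dirD_one_eq_zero (h.comp_isometry (rotation c).toLinearIsometry)
  have e : dirD 1 (fun w => F ((rotation c).toLinearIsometry w)) =
      fun w => dirD v F (rotation c w) := by
    have := dirD_comp_clm (rotation c).toLinearIsometry.toContinuousLinearMap
      h.1.differentiable_infty 1
    have hv1 : (rotation c).toLinearIsometry.toContinuousLinearMap 1 = v := by
      change (rotation c) 1 = v
      rw [rotation_apply, mul_one]
    rw [hv1] at this
    exact this
  rw [e, integral_comp (rotation c) (dirD v F)] at h1
  exact h1

/-- Multiplication by the coordinate commutes with the Cauchy transform on functions of vanishing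
integral. -/
lemma mul_cauchy {G : ℂ → ℂ} (hG : Decays (-5 / 2) G) (h0 : ∫ w, G w = 0) (z : ℂ) :
    z * cauchy G z = cauchy (fun w => w * G w) z := by
  have hG' : Decays (-3 / 2) G := hG.mono (by norm_num)
  have hwG : Decays (-3 / 2) (fun w => w * G w) := by
    have := hG.linear_mul (ContinuousLinearMap.id ℝ ℂ)
    rwa [show (-5 / 2 + 1 : ℝ) = -3 / 2 by norm_num] at this
  obtain ⟨M₁, -, hM₁⟩ := hG'.exists_bound (by norm_num)
  obtain ⟨M₂, -, hM₂⟩ := hwG.exists_bound (by norm_num)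
  have i1 := integrable_cauchy hG'.1.continuous hM₁ z
  have i2 := integrable_cauchy hwG.1.continuous hM₂ z
  -- The factor `z - (z - w) = w` cancels the kernel off `w = 0`, leaving the integral of `G`.
  have e : (∫ w, z * (G (z - w) * w⁻¹)) - ∫ w, (z - w) * G (z - w) * w⁻¹ = 0 := by
    rw [← integral_sub (i1.const_mul z) i2]
    have : ∫ w, G (z - w) = 0 := by rw [integral_sub_left_eq_self G volume z, h0]
    rw [← this]
    refine integral_congr_ae ?_
    filter_upwards [ae_ne_zero] with w hw
    field_simp
    ring
  rw [integral_const_mul] at e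
  simp only [cauchy]
  linear_combination (Real.pi : ℂ)⁻¹ * e

end Pompeiu

end AxiGauge

namespace AxiGauge

open Filter Asymptotics Bornology MeasureTheory
open scoped Topology

/-! ### Decay of all derivatives of the Cauchy transform -/

section CauchyDecay

open Complex

lemma cauchy_sub_const_mul {F G : ℂ → ℂ} (hF : Decays (-3 / 2) F) (hG : Decays (-3 / 2) G)
    (c z : ℂ) : cauchy (fun w => F w - c * G w) z = cauchy F z - c * cauchy G z := by
  obtain ⟨M₁, -, hM₁⟩ := hF.exists_bound (by norm_num)
  obtain ⟨M₂, -, hM₂⟩ := hG.exists_bound (by norm_num)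
  have i1 := integrable_cauchy hF.1.continuous hM₁ z
  have i2 := integrable_cauchy hG.1.continuous hM₂ z
  have : ∫ w, (F (z - w) - c * G (z - w)) * w⁻¹ =
      (∫ w, F (z - w) * w⁻¹) - c * ∫ w, G (z - w) * w⁻¹ := by
    rw [← integral_const_mul, ← integral_sub i1 (i2.const_mul c)]
    congr 1; ext w; ring
  simp only [cauchy, this]
  ring

lemma dirD_complex (f : ℂ → ℂ) (v : ℂ) :
    dirD v f = fun z => v.re * dirD 1 f z + v.im * dirD I f z := by
  ext z
  simp only [dirD]
  have rl : ∀ (L : ℂ →L[ℝ] ℂ) (a : ℝ) (v : ℂ), L (a * v) = a * L v := by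
    intro L a v
    simpa only [real_smul] using L.map_smul a v
  rw [← rl, ← rl, ← map_add, mul_one, Complex.re_add_im]

/-- The induction must range over all `F`, because the bound for `∂B/∂z` comes from the transform of
the different function `w H(w)`. -/
lemma decaysN_cauchy (n : ℕ) : ∀ {F : ℂ → ℂ}, Decays (-3 / 2) F →
    DecaysN (cobounded ℂ) n (-1 / 2) (cauchy F) := by
  induction n with
  | zero => exact fun h => cauchy_isLittleO h.1.continuous h.isLittleO
  | succ n ih =>
    intro F h
    refine ⟨cauchy_isLittleO h.1.continuous h.isLittleO, fun v => ?_⟩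
    -- `H = 2 ∂F/∂z`. A nonzero integral of `H` would leave a term of size `1/r` in its transform.
    -- As the integral vanishes, `z · cauchy H` is the transform of `w H(w)`, which has weight
    -- `-3/2` again.
    set H : ℂ → ℂ := fun w => dirD 1 F w - I * dirD I F w with hH
    have dH : Decays (-5 / 2) H := by
      have := (h.dirD 1).sub ((h.dirD I).const_mul I)
      rwa [show (-3 / 2 - 1 : ℝ) = -5 / 2 by norm_num] at this
    have dH' : Decays (-3 / 2) H := dH.mono (by norm_num)
    have iH : ∫ w, H w = 0 := by
      have j1 := (h.dirD 1).integrable_of_lt (by norm_num)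
      have j2 := (h.dirD I).integrable_of_lt (by norm_num)
      simp only [hH]
      rw [integral_sub j1 (j2.const_mul I), integral_const_mul,
        integral_dirD_eq_zero h (by simp), integral_dirD_eq_zero h (by simp)]
      simp
    have dwH : Decays (-3 / 2) (fun w => w * H w) := by
      have := dH.linear_mul (ContinuousLinearMap.id ℝ ℂ)
      rwa [show (-5 / 2 + 1 : ℝ) = -3 / 2 by norm_num] at this
    have step : DecaysN (cobounded ℂ) n (-1 / 2 - 1) (cauchy H) := by
      refine DecaysN.of_linear_mul le_rfl (ContinuousLinearMap.id ℝ ℂ) ?_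
        (contDiff_cauchy dH') ?_
      · exact (isBigO_refl _ _).norm_left
      · have := ih dwH
        refine (congrArg (DecaysN (cobounded ℂ) n (-1 / 2)) ?_).mp this
        ext z
        exact (mul_cauchy dH iH z).symm
    have hFn : DecaysN (cobounded ℂ) n (-1 / 2 - 1) F := by
      have := h.2 n
      rwa [show (-3 / 2 : ℝ) = -1 / 2 - 1 by norm_num] at this
    have e1 : ∀ z, cauchy H z = dirD 1 (cauchy F) z - I * dirD I (cauchy F) z := by
      intro z
      rw [dirD_cauchy h, dirD_cauchy h, cauchy_sub_const_mul (h.dirD' 1) (h.dirD' I)]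
    have e2 := dbar_cauchy h
    -- Every directional derivative is a combination of `∂/∂z̄` and `∂/∂z`, here `∂B/∂z̄ = F` and
    -- `∂B/∂z = cauchy H / 2`.
    have e : dirD v (cauchy F) = fun z => ContinuousLinearMap.mul ℝ ℂ (v.re + v.im * (-I)) (F z) +
        ContinuousLinearMap.mul ℝ ℂ ((v.re + v.im * I) / 2) (cauchy H z) := by
      rw [dirD_complex]
      ext z
      simp only [ContinuousLinearMap.mul_apply', e1]
      linear_combination ((v.re : ℂ) / 2 - v.im * I / 2) * e2 z +
        (v.im * dirD I (cauchy F) z) * I_sq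
    rw [e]
    exact DecaysN.add ((ContinuousLinearMap.contDiff _).comp h.1)
      ((ContinuousLinearMap.contDiff _).comp (contDiff_cauchy dH'))
      (DecaysN.clm_comp _ h.1 hFn) (DecaysN.clm_comp _ (contDiff_cauchy dH') step)

lemma decays_cauchy {F : ℂ → ℂ} (h : Decays (-3 / 2) F) : Decays (-1 / 2) (cauchy F) :=
  ⟨contDiff_cauchy h, fun n => decaysN_cauchy n h⟩

end CauchyDecay

/-! ### The Cauchy–Riemann system and Liouville's theorem on the Euclidean plane -/

section Plane

open Complex

/-- The identification of `ℂ` with the Euclidean plane. -/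
noncomputable def toPlane : ℂ ≃ₗᵢ[ℝ] E 2 := Complex.orthonormalBasisOneI.repr

lemma toPlane_one : toPlane 1 = EuclideanSpace.single 0 1 := by
  ext i; fin_cases i <;> simp [toPlane]

lemma toPlane_I : toPlane I = EuclideanSpace.single 1 1 := by
  ext i; fin_cases i <;> simp [toPlane]

lemma dirD_comp_toPlane {f : E 2 → ℝ} (hf : Differentiable ℝ f) (v : ℂ) :
    dirD v (fun z => f (toPlane z)) = fun z => dirD (toPlane v) f (toPlane z) :=
  dirD_comp_clm toPlane.toLinearIsometry.toContinuousLinearMap hf v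

/-- Solvability of the inhomogeneous Cauchy–Riemann system with decay. -/
lemma exists_cauchyRiemann {a b : E 2 → ℝ} (ha : Decays (-3 / 2) a) (hb : Decays (-3 / 2) b) :
    ∃ u v : E 2 → ℝ, Decays (-1 / 2) u ∧ Decays (-1 / 2) v ∧
      (∀ p, pd 0 u p - pd 1 v p = 2 * a p) ∧ ∀ p, pd 1 u p + pd 0 v p = 2 * b p := by
  set F : ℂ → ℂ := fun z => a (toPlane z) + I * b (toPlane z)
  have dF : Decays (-3 / 2) F :=
    ((ha.comp_isometry toPlane.toLinearIsometry).clm_comp ofRealCLM).add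
      (((hb.comp_isometry toPlane.toLinearIsometry).clm_comp ofRealCLM).const_mul I)
  have dB := decays_cauchy dF
  set B := cauchy F
  have dB' := dB.comp_isometry toPlane.symm.toLinearIsometry
  have hpd : ∀ (L : ℂ →L[ℝ] ℝ) (i : Fin 2) (z : ℂ), toPlane z = EuclideanSpace.single i 1 →
      ∀ p, pd i (fun p => L (B (toPlane.symm p))) p = L (dirD z B (toPlane.symm p)) := by
    intro L i z hz p
    rw [pd_eq_dirD, ← hz]
    have h1 := dirD_clm_comp L dB'.1.differentiable_infty (toPlane z)
    have h2 := dirD_comp_clm toPlane.symm.toLinearIsometry.toContinuousLinearMap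
      dB.1.differentiable_infty (toPlane z)
    refine (congrFun h1 p).trans (congrArg L ((congrFun h2 p).trans ?_))
    change dirD (toPlane.symm (toPlane z)) B _ = _
    rw [toPlane.symm_apply_apply]
    rfl
  refine ⟨fun p => reCLM (B (toPlane.symm p)), fun p => imCLM (B (toPlane.symm p)),
    dB'.clm_comp reCLM, dB'.clm_comp imCLM, fun p => ?_, fun p => ?_⟩ <;>
  · rw [hpd _ 0 1 toPlane_one, hpd _ 1 I toPlane_I]
    have := dbar_cauchy dF (toPlane.symm p)
    simp only [F, toPlane.apply_symm_apply] at this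
    have h1 := congrArg re this
    have h2 := congrArg im this
    simp at h1 h2
    simp only [reCLM_apply, imCLM_apply]
    first | exact h1 | linarith

/-- A decaying harmonic function on the plane vanishes. -/
lemma eq_zero_of_harmonic {h : E 2 → ℝ} (hd : Decays (-1 / 2) h)
    (hh : ∀ p, pd 0 (pd 0 h) p + pd 1 (pd 1 h) p = 0) : h = 0 := by
  set H : ℂ → ℝ := fun z => h (toPlane z)
  have dH : Decays (-1 / 2) H := hd.comp_isometry toPlane.toLinearIsometry
  have e : ∀ v w z, dirD v (dirD w H) z = dirD (toPlane v) (dirD (toPlane w) h) (toPlane z) := by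
    intro v w z
    rw [dirD_comp_toPlane hd.1.differentiable_infty,
      dirD_comp_toPlane (contDiff_dirD hd.1 _).differentiable_infty]
  have lap : ∀ z, dirD 1 (dirD 1 H) z + dirD I (dirD I H) z = 0 := by
    intro z
    rw [e, e, toPlane_one, toPlane_I]
    exact hh _
  -- `f = 2 ∂H/∂z` is entire because `H` is harmonic, and it tends to zero. Liouville then makes the
  -- gradient vanish.
  set f : ℂ → ℂ := fun z => ofRealCLM (dirD 1 H z) - I * ofRealCLM (dirD I H z)
  have d1 := (dH.dirD 1).clm_comp ofRealCLM
  have dI := (dH.dirD I).clm_comp ofRealCLM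
  have df : Decays (-1 / 2 - 1) f := d1.sub (dI.const_mul I)
  have Df : ∀ v, dirD v f = fun z => ((dirD v (dirD 1 H) z : ℝ) : ℂ) - I * (dirD v (dirD I H) z : ℝ) := by
    intro v
    simp only [f]
    rw [dirD_sub d1.1.differentiable_infty (dI.const_mul I).1.differentiable_infty,
      dirD_clm_comp ofRealCLM (dH.dirD 1).1.differentiable_infty]
    ext z
    have := dirD_clm_comp (ContinuousLinearMap.mul ℝ ℂ I) dI.1.differentiable_infty v
    simp only [ContinuousLinearMap.mul_apply'] at this
    rw [this, dirD_clm_comp ofRealCLM (dH.dirD I).1.differentiable_infty]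
    rfl
  have hol : Differentiable ℂ f := by
    intro z
    refine differentiableAt_complex_iff_differentiableAt_real.2
      ⟨df.1.differentiable_infty z, ?_⟩
    change dirD I f z = I • dirD 1 f z
    rw [Df, Df, smul_eq_mul, dirD_comm dH.1 1 I]
    have := lap z
    have h2 : ((dirD 1 (dirD 1 H) z : ℝ) : ℂ) = -(dirD I (dirD I H) z : ℝ) := by
      rw [← ofReal_neg]; congr 1; linarith
    simp only
    rw [h2]
    linear_combination ((dirD I (dirD 1 H) z : ℝ) : ℂ) * I_sq
  have f0 : ∀ z, f z = 0 := fun z => hol.apply_eq_of_tendsto_cocompact z (by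
    rw [← Metric.cobounded_eq_cocompact]
    exact df.tendsto_zero (by norm_num))
  have H0 : ∀ z, fderiv ℝ H z = 0 := by
    intro z
    have h1 := congrArg re (f0 z)
    have h2 := congrArg im (f0 z)
    simp [f] at h1 h2
    ext v
    have : v = v.re • (1 : ℂ) + v.im • I := by simp [Complex.re_add_im]
    rw [this, map_add, map_smul, map_smul]
    change v.re • dirD 1 H z + v.im • dirD I H z = 0
    simp [h1, h2]
  have Hc : ∀ z w, H z = H w := is_const_of_fderiv_eq_zero dH.1.differentiable_infty H0
  have ht := dH.tendsto_zero (by norm_num)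
  have : H = fun _ => H 0 := funext fun z => Hc z 0
  rw [this] at ht
  have h00 : H 0 = 0 := tendsto_nhds_unique tendsto_const_nhds ht
  ext p
  have := Hc (toPlane.symm p) 0
  simp only [H, toPlane.apply_symm_apply] at this
  exact this.trans h00

/-- The second-order system implied by the first-order one. -/
lemma laplace_of_cauchyRiemann {u v a b : E 2 → ℝ} (hu : ContDiff ℝ ∞ u) (hv : ContDiff ℝ ∞ v)
    (ha : ContDiff ℝ ∞ a) (hb : ContDiff ℝ ∞ b)
    (h1 : ∀ p, pd 0 u p - pd 1 v p = 2 * a p) (h2 : ∀ p, pd 1 u p + pd 0 v p = 2 * b p) (p : E 2) :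
    pd 0 (pd 0 u) p + pd 1 (pd 1 u) p = 2 * (pd 0 a p + pd 1 b p) ∧
      pd 0 (pd 0 v) p + pd 1 (pd 1 v) p = 2 * (pd 0 b p - pd 1 a p) := by
  have e1 : pd 0 u = fun p => pd 1 v p + (ContinuousLinearMap.mul ℝ ℝ 2) (a p) := by
    ext p; have := h1 p; simp; linarith
  have e2 : pd 1 u = fun p => (ContinuousLinearMap.mul ℝ ℝ 2) (b p) - pd 0 v p := by
    ext p; have := h2 p; simp; linarith
  have cv : ∀ i, Differentiable ℝ (pd i v) := fun i => (contDiff_dirD hv _).differentiable_infty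
  have da := ha.differentiable_infty
  have db := hb.differentiable_infty
  have da2 : Differentiable ℝ fun p => (ContinuousLinearMap.mul ℝ ℝ 2) (a p) :=
    (ContinuousLinearMap.differentiable _).comp da
  have db2 : Differentiable ℝ fun p => (ContinuousLinearMap.mul ℝ ℝ 2) (b p) :=
    (ContinuousLinearMap.differentiable _).comp db
  have k1 : ∀ i, pd i (pd 0 u) p = pd i (pd 1 v) p + 2 * pd i a p := by
    intro i
    rw [e1, pd_eq_dirD, dirD_add (cv 1) da2, dirD_clm_comp _ da]
    rfl
  have k2 : ∀ i, pd i (pd 1 u) p = 2 * pd i b p - pd i (pd 0 v) p := by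
    intro i
    rw [e2, pd_eq_dirD, dirD_sub db2 (cv 0), dirD_clm_comp _ db]
    rfl
  have su : pd 1 (pd 0 u) p = pd 0 (pd 1 u) p := congrFun (dirD_comm hu _ _) p
  have sv : pd 1 (pd 0 v) p = pd 0 (pd 1 v) p := congrFun (dirD_comm hv _ _) p
  have := k1 0
  have := k1 1
  have := k2 0
  have := k2 1
  constructor <;> linarith

end Plane

end AxiGauge

namespace AxiGauge

open Filter Asymptotics Bornology MeasureTheory
open scoped Topology

/-! ### Division of an odd function by the coordinate `ρ` -/

section Hadamard

lemma hasFDerivAt_intervalIntegral_of_continuous {V W : Type*} [NormedAddCommGroup V]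
    [NormedSpace ℝ V] [ProperSpace V] [NormedAddCommGroup W] [NormedSpace ℝ W]
    {F : V → ℝ → W} {F' : V → ℝ → V →L[ℝ] W}
    (hF : Continuous fun q : V × ℝ => F q.1 q.2) (hF' : Continuous fun q : V × ℝ => F' q.1 q.2)
    (hd : ∀ x t, HasFDerivAt (fun x => F x t) (F' x t) x) (a b : ℝ) (x : V) :
    HasFDerivAt (fun x => ∫ t in a..b, F x t) (∫ t in a..b, F' x t) x := by
  obtain ⟨C, hC⟩ := ((isCompact_closedBall x 1).prod (isCompact_uIcc (a := a) (b := b))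
    ).exists_bound_of_continuousOn hF'.continuousOn
  have c1 : ∀ x, Continuous (F x) := fun x => hF.comp (continuous_const.prodMk continuous_id)
  have c2 : Continuous (F' x) := hF'.comp (continuous_const.prodMk continuous_id)
  exact intervalIntegral.hasFDerivAt_integral_of_dominated_of_fderiv_le (bound := fun _ => C)
    (Metric.ball_mem_nhds x one_pos)
    (Eventually.of_forall fun x => (c1 x).aestronglyMeasurable)
    ((c1 x).intervalIntegrable _ _) c2.aestronglyMeasurable
    (ae_of_all _ fun t ht y hy => hC (y, t) ⟨Metric.ball_subset_closedBall hy,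
      Set.uIoc_subset_uIcc ht⟩)
    intervalIntegrable_const (ae_of_all _ fun t _ y _ => hd y t)

/-- The map `(ρ, z) ↦ (t ρ, z)`. -/
noncomputable def scaleRho (t : ℝ) : E 2 →L[ℝ] E 2 :=
  ContinuousLinearMap.id ℝ (E 2) + (t - 1) •
    (EuclideanSpace.proj (0 : Fin 2) : E 2 →L[ℝ] ℝ).smulRight (EuclideanSpace.single (0 : Fin 2) (1 : ℝ))

@[simp] lemma scaleRho_zero (t : ℝ) (p : E 2) : scaleRho t p 0 = t * p 0 := by
  simp [scaleRho]; ring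

@[simp] lemma scaleRho_one (t : ℝ) (p : E 2) : scaleRho t p 1 = p 1 := by
  simp [scaleRho]

lemma continuous_scaleRho : Continuous scaleRho := by
  unfold scaleRho; fun_prop

lemma continuous_scaleRho_apply : Continuous fun q : E 2 × ℝ => scaleRho q.2 q.1 :=
  (continuous_scaleRho.comp continuous_snd).clm_apply continuous_fst

/-- The average of `t^j h(tρ, z)` over `0 ≤ t ≤ 1`. -/
noncomputable def rhoAverage (j : ℕ) (h : E 2 → ℝ) (p : E 2) : ℝ :=
  ∫ t in (0 : ℝ)..1, t ^ j * h (scaleRho t p)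

lemma hasFDerivAt_rhoAverage (j : ℕ) {h : E 2 → ℝ} (hh : ContDiff ℝ ∞ h) (p : E 2) :
    HasFDerivAt (rhoAverage j h)
      (∫ t in (0 : ℝ)..1, t ^ j • (fderiv ℝ h (scaleRho t p)).comp (scaleRho t)) p := by
  have hc : Continuous (fderiv ℝ h) := (hh.fderiv_right (m := ∞) (by simp)).continuous
  refine hasFDerivAt_intervalIntegral_of_continuous
    (F := fun p t => t ^ j * h (scaleRho t p))
    (F' := fun p t => t ^ j • (fderiv ℝ h (scaleRho t p)).comp (scaleRho t)) ?_ ?_ ?_ 0 1 p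
  · exact (continuous_snd.pow j).mul (hh.continuous.comp continuous_scaleRho_apply)
  · exact (continuous_snd.pow j).smul ((hc.comp continuous_scaleRho_apply).clm_comp
      (continuous_scaleRho.comp continuous_snd))
  · intro x t
    exact ((hh.differentiable_infty _).hasFDerivAt.comp x (scaleRho t).hasFDerivAt).const_mul _

lemma continuous_rhoAverage_integrand (j : ℕ) {h : E 2 → ℝ} (hh : Continuous h) (p : E 2) :
    Continuous fun t : ℝ => t ^ j * h (scaleRho t p) :=
  (continuous_id.pow j).mul (hh.comp (continuous_scaleRho.clm_apply continuous_const))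

/-- Each `ρ`-derivative brings out a factor `t`. The weights `t^j` make the class of averages closed
under differentiation, which drives the inductions below. -/
lemma dirD_rhoAverage (j : ℕ) {h : E 2 → ℝ} (hh : ContDiff ℝ ∞ h) (v : E 2) :
    dirD v (rhoAverage j h) =
      fun p => v 0 * rhoAverage (j + 1) (pd 0 h) p + v 1 * rhoAverage j (pd 1 h) p := by
  ext p
  have hc : Continuous (fderiv ℝ h) := (hh.fderiv_right (m := ∞) (by simp)).continuous
  have hs : Continuous fun t => scaleRho t p := continuous_scaleRho.clm_apply continuous_const
  have hi : Continuous fun t : ℝ => t ^ j • (fderiv ℝ h (scaleRho t p)).comp (scaleRho t) :=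
    (continuous_id.pow j).smul ((hc.comp hs).clm_comp continuous_scaleRho)
  rw [dirD, (hasFDerivAt_rhoAverage j hh p).fderiv,
    ContinuousLinearMap.intervalIntegral_apply (hi.intervalIntegrable _ _)]
  have c : ∀ i, Continuous (pd i h) := fun i => (contDiff_dirD hh _).continuous
  have i0 := (continuous_rhoAverage_integrand (j + 1) (c 0) p).intervalIntegrable
    (μ := volume) 0 1
  have i1 := (continuous_rhoAverage_integrand j (c 1) p).intervalIntegrable (μ := volume) 0 1
  simp only [rhoAverage]
  rw [← intervalIntegral.integral_const_mul, ← intervalIntegral.integral_const_mul,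
    ← intervalIntegral.integral_add (i0.const_mul _) (i1.const_mul _)]
  congr 1
  ext t
  have := congrFun (dirD_eq_sum (scaleRho t v) h) (scaleRho t p)
  simp only [Fin.sum_univ_two, scaleRho_zero, scaleRho_one] at this
  change t ^ j * dirD (scaleRho t v) h (scaleRho t p) = _
  rw [this]
  ring

lemma contDiff_rhoAverage (j : ℕ) {h : E 2 → ℝ} (hh : ContDiff ℝ ∞ h) :
    ContDiff ℝ ∞ (rhoAverage j h) := by
  have key : ∀ n : ℕ, ∀ j, ∀ h : E 2 → ℝ, ContDiff ℝ ∞ h → ContDiff ℝ n (rhoAverage j h) := by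
    intro n
    induction n with
    | zero =>
      intro j h hh
      have : Differentiable ℝ (rhoAverage j h) :=
        fun z => (hasFDerivAt_rhoAverage j hh z).differentiableAt
      exact contDiff_zero.2 this.continuous
    | succ n ih =>
      intro j h hh
      rw [Nat.cast_succ]
      refine contDiff_succ_iff_fderiv_apply.2
        ⟨fun z => (hasFDerivAt_rhoAverage j hh z).differentiableAt,
          fun hn => absurd hn (WithTop.natCast_ne_top n), fun v => ?_⟩
      have := dirD_rhoAverage j hh v
      unfold dirD at this
      rw [this]
      exact (contDiff_const.mul (ih _ _ (contDiff_dirD hh _))).add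
        (contDiff_const.mul (ih _ _ (contDiff_dirD hh _)))
  exact contDiff_infty.2 fun n => key n j h hh

lemma norm_le_two_mul_abs {p : E 2} {i k : Fin 2} (hik : i ≠ k) (h : |p i| ≤ |p k|) :
    ‖p‖ ≤ 2 * |p k| := by
  rw [EuclideanSpace.norm_eq, Real.sqrt_le_left (by positivity), Fin.sum_univ_two]
  have : p 0 ^ 2 + p 1 ^ 2 = |p i| ^ 2 + |p k| ^ 2 := by
    fin_cases i <;> fin_cases k <;> simp_all [add_comm]
  simp only [Real.norm_eq_abs, sq_abs] at this ⊢
  rw [this, ← sq_abs (p i), ← sq_abs (p k)]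
  nlinarith [abs_nonneg (p i), abs_nonneg (p k)]

/-- On the cone `|ρ| ≤ |z|` the segment from `(0, z)` to `(ρ, z)` stays at distance at least `r/2`
from the origin, so the average inherits the decay. Outside the cone the segment may come close to
the origin. -/
lemma decaysN_rhoAverage (n : ℕ) : ∀ (j : ℕ) {k : ℝ} {h : E 2 → ℝ}, k ≤ 0 → Decays k h →
    DecaysN (cobounded (E 2) ⊓ 𝓟 {p | |p 0| ≤ |p 1|}) n k (rhoAverage j h) := by
  have key : ∀ (j : ℕ) {k : ℝ} {h : E 2 → ℝ}, k ≤ 0 → Decays k h →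
      rhoAverage j h =o[cobounded (E 2) ⊓ 𝓟 {p | |p 0| ≤ |p 1|}] fun p => ‖p‖ ^ k := by
    intro j k h hk hh
    refine IsLittleO.of_bound fun ε hε => ?_
    -- The factor `2 ^ (-k)` pays for replacing `‖scaleRho t p‖` by `‖p‖ / 2` in a nonpositive
    -- power.
    have hb := hh.isLittleO.bound (c := ε / 2 ^ (-k)) (by positivity)
    rw [(Metric.hasBasis_cobounded_compl_closedBall (0 : E 2)).eventually_iff] at hb
    obtain ⟨R, -, hR⟩ := hb
    have hlarge : ∀ᶠ p : E 2 in cobounded (E 2), 2 * |R| + 1 ≤ ‖p‖ :=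
      tendsto_norm_cobounded_atTop.eventually_ge_atTop _
    filter_upwards [hlarge.filter_mono inf_le_left, mem_inf_of_right (mem_principal_self _)]
      with p hp hp1
    have hn := norm_le_two_mul_abs (p := p) zero_ne_one hp1
    rw [Real.norm_of_nonneg (r := ‖p‖ ^ k) (by positivity)]
    have := intervalIntegral.norm_integral_le_of_norm_le_const (a := 0) (b := 1)
      (C := ε * ‖p‖ ^ k) (f := fun t : ℝ => t ^ j * h (scaleRho t p)) (fun t ht => by
        rw [Set.uIoc_of_le zero_le_one] at ht
        have ht0 : 0 ≤ t := ht.1.le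
        have hs : ‖p‖ / 2 ≤ ‖scaleRho t p‖ := by
          have := PiLp.norm_apply_le (scaleRho t p) 1
          rw [scaleRho_one, Real.norm_eq_abs] at this
          linarith
        have h3 := hR (x := scaleRho t p) (by
          have := le_abs_self R
          have : R < ‖scaleRho t p‖ := by linarith
          simpa using this)
        have hp0 : 0 < ‖p‖ := by linarith [abs_nonneg R]
        rw [Real.norm_of_nonneg (r := ‖scaleRho t p‖ ^ k) (by positivity)] at h3
        rw [norm_mul, Real.norm_of_nonneg (by positivity)]
        refine (mul_le_of_le_one_left (norm_nonneg _) (pow_le_one₀ ht0 ht.2)).trans ?_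
        refine h3.trans ?_
        have h4 : ‖scaleRho t p‖ ^ k ≤ (‖p‖ / 2) ^ k :=
          Real.rpow_le_rpow_of_nonpos (by positivity) hs hk
        have h5 : (‖p‖ / 2) ^ k = 2 ^ (-k) * ‖p‖ ^ k := by
          rw [Real.div_rpow (by positivity) (by norm_num), Real.rpow_neg (by norm_num),
            div_eq_inv_mul]
        rw [h5] at h4
        have h6 : (0 : ℝ) < 2 ^ (-k) := by positivity
        calc ε / 2 ^ (-k) * ‖scaleRho t p‖ ^ k ≤ ε / 2 ^ (-k) * (2 ^ (-k) * ‖p‖ ^ k) := by gcongr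
          _ = ε * ‖p‖ ^ k := by field_simp)
    simpa [rhoAverage] using this
  induction n with
  | zero => exact fun j _ _ hk hh => key j hk hh
  | succ n ih =>
    intro j k h hk hh
    refine ⟨key j hk hh, fun v => ?_⟩
    rw [dirD_rhoAverage j hh.1]
    have c : ∀ i m, ContDiff ℝ ∞ (rhoAverage m (pd i h)) :=
      fun i m => contDiff_rhoAverage m (contDiff_dirD hh.1 _)
    exact DecaysN.add (contDiff_const.mul (c _ _)) (contDiff_const.mul (c _ _))
      (DecaysN.clm_comp (ContinuousLinearMap.mul ℝ ℝ (v 0)) (c _ _)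
        (ih (j + 1) (by linarith) (hh.dirD _)))
      (DecaysN.clm_comp (ContinuousLinearMap.mul ℝ ℝ (v 1)) (c _ _)
        (ih j (by linarith) (hh.dirD _)))

/-- A decaying function vanishing on the axis `ρ = 0` is `ρ` times a smooth function, which decays
one order faster. -/
lemma exists_div_rho {k : ℝ} (hk : k ≤ 0) {f : E 2 → ℝ} (hf : Decays k f)
    (h0 : ∀ p : E 2, p 0 = 0 → f p = 0) :
    ∃ g : E 2 → ℝ, Decays (k - 1) g ∧ ∀ p, p 0 * g p = f p := by
  set g := rhoAverage 0 (pd 0 f) with hg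
  have cg : ContDiff ℝ ∞ g := contDiff_rhoAverage 0 (contDiff_dirD hf.1 _)
  have hmul : ∀ p, p 0 * g p = f p := by
    intro p
    have hd : ∀ t ∈ Set.uIcc (0 : ℝ) 1,
        HasDerivAt (fun t => f (scaleRho t p)) (p 0 * (t ^ 0 * pd 0 f (scaleRho t p))) t := by
      intro t _
      have h1 : HasDerivAt (fun t => scaleRho t p)
          (p 0 • EuclideanSpace.single (0 : Fin 2) (1 : ℝ)) t := by
        have : HasDerivAt (fun t : ℝ => p + (t - 1) • (p 0 • EuclideanSpace.single (0 : Fin 2) (1 : ℝ)))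
            ((1 : ℝ) • (p 0 • EuclideanSpace.single (0 : Fin 2) (1 : ℝ))) t :=
          (((hasDerivAt_id t).sub_const 1).smul_const _).const_add p
        rw [one_smul] at this
        exact this
      have h2 := (hf.1.differentiable_infty (scaleRho t p)).hasFDerivAt.comp_hasDerivAt t h1
      refine h2.congr_deriv ?_
      rw [map_smul]
      simp [pd]
    have hc := (continuous_rhoAverage_integrand 0 (contDiff_dirD hf.1
      (EuclideanSpace.single 0 1)).continuous p)
    have := intervalIntegral.integral_eq_sub_of_hasDerivAt hd
      ((continuous_const.mul hc).intervalIntegrable _ _)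
    rw [intervalIntegral.integral_const_mul] at this
    have e1 : scaleRho 1 p = p := by simp [scaleRho]
    rw [e1, h0 (scaleRho 0 p) (by simp), sub_zero] at this
    exact this
  refine ⟨g, ⟨cg, fun n => ?_⟩, hmul⟩
  -- Away from the axis `ρ` is comparable to `r` and `f` can be divided by it; near the axis
  -- Hadamard's integral for `g` is estimated directly.
  have hcov : cobounded (E 2) ≤ (cobounded (E 2) ⊓ 𝓟 {p | |p 1| ≤ |p 0|}) ⊔
      (cobounded (E 2) ⊓ 𝓟 {p | |p 0| ≤ |p 1|}) := by
    rw [← inf_sup_left, sup_principal]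
    refine le_inf le_rfl (le_principal_iff.2 ?_)
    refine univ_mem' fun p => le_total |p 1| |p 0|
  refine DecaysN.filter_mono hcov (DecaysN.sup ?_ ?_)
  · refine DecaysN.of_linear_mul inf_le_left (EuclideanSpace.proj (0 : Fin 2) : E 2 →L[ℝ] ℝ) ?_ cg ?_
    · refine IsBigO.of_bound 2 ?_
      filter_upwards [mem_inf_of_right (mem_principal_self _)] with p hp
      rw [norm_norm]
      exact norm_le_two_mul_abs one_ne_zero hp
    · refine DecaysN.filter_mono inf_le_left ?_
      refine (congrArg (DecaysN (cobounded (E 2)) n k) ?_).mpr (hf.2 n)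
      ext p
      exact hmul p
  · exact decaysN_rhoAverage n 0 (by linarith) (hf.dirD _)

end Hadamard

end AxiGauge

namespace AxiGauge

open Filter Asymptotics Bornology MeasureTheory
open scoped Topology

/-! ### Reflections of coordinates -/

section Flip

variable {n : ℕ}

/-- The linear isometry changing the coordinate `i` by the sign `s i`. -/
noncomputable def flip (s : Fin n → ℝ) (hs : ∀ i, s i * s i = 1) : E n →ₗᵢ[ℝ] E n where
  toFun p := WithLp.toLp 2 fun i => s i * p i
  map_add' p q := by ext i; simp [mul_add]
  map_smul' c p := by ext i; simp; ring
  norm_map' p := by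
    simp only [LinearMap.coe_mk, AddHom.coe_mk, EuclideanSpace.norm_eq]
    congr 1
    refine Finset.sum_congr rfl fun i _ => ?_
    have := hs i
    simp only [Real.norm_eq_abs, sq_abs]
    linear_combination (p i) ^ 2 * this

variable {s : Fin n → ℝ} {hs : ∀ i, s i * s i = 1}

lemma flip_apply (p : E n) (i : Fin n) : flip s hs p i = s i * p i := rfl

lemma flip_single (i : Fin n) :
    flip s hs (EuclideanSpace.single i 1) = s i • EuclideanSpace.single i (1 : ℝ) := by
  ext j
  rw [flip_apply]
  by_cases h : j = i
  · subst h; simp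
  · simp [h]

lemma pd_comp_flip {f : E n → ℝ} (hf : Differentiable ℝ f) (i : Fin n) :
    pd i (fun p => f (flip s hs p)) = fun p => s i * pd i f (flip s hs p) := by
  rw [pd_eq_dirD]
  have := dirD_comp_clm (flip s hs).toContinuousLinearMap hf (EuclideanSpace.single i 1)
  refine this.trans ?_
  ext p
  change dirD (flip s hs (EuclideanSpace.single i 1)) f _ = _
  rw [flip_single, dirD_smul_vec]
  rfl

lemma pd_const_mul {f : E n → ℝ} (hf : Differentiable ℝ f) (c : ℝ) (i : Fin n) :
    pd i (fun p => c * f p) = fun p => c * pd i f p :=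
  dirD_clm_comp (ContinuousLinearMap.mul ℝ ℝ c) hf _

lemma pd_coord (i j : Fin n) (p : E n) : pd i (fun q : E n => q j) p = if j = i then 1 else 0 := by
  have := congrFun (dirD_clm (EuclideanSpace.proj j : E n →L[ℝ] ℝ) (EuclideanSpace.single i 1)) p
  refine this.trans ?_
  simp

end Flip

/-! ### Axially symmetric tensor fields -/

section Axisymmetric

/-- The rotation by `θ` about the `z`-axis. -/
noncomputable def axialRotation (θ : ℝ) (p : E 3) : E 3 :=
  Real.cos θ • (!₂[p 0, p 1, 0] : E 3) + Real.sin θ • (!₂[-p 1, p 0, 0] : E 3) + !₂[0, 0, p 2]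

lemma hasDerivAt_axialRotation (θ : ℝ) (p : E 3) :
    HasDerivAt (fun θ => axialRotation θ p)
      (!₂[-axialRotation θ p 1, axialRotation θ p 0, 0] : E 3) θ := by
  have := (((Real.hasDerivAt_cos θ).smul_const (!₂[p 0, p 1, 0] : E 3)).add
    ((Real.hasDerivAt_sin θ).smul_const (!₂[-p 1, p 0, 0] : E 3))).add_const (!₂[0, 0, p 2] : E 3)
  refine this.congr_deriv ?_
  ext i
  fin_cases i <;> simp [axialRotation]
  ring

lemma pd_axialField (a c : Fin 3) (p : E 3) :
    pd a (axialField c) p = (!![0, -1, 0; 1, 0, 0; 0, 0, 0] : Matrix (Fin 3) (Fin 3) ℝ) c a := by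
  fin_cases c
  · have h : axialField 0 = fun p : E 3 => (-1 : ℝ) * p 1 := by ext; simp [axialField]
    have hd : Differentiable ℝ fun p : E 3 => p 1 :=
      (EuclideanSpace.proj (1 : Fin 3) : E 3 →L[ℝ] ℝ).differentiable
    simp only [Fin.zero_eta, h, pd_const_mul hd, pd_coord]
    fin_cases a <;> simp
  · have h : axialField 1 = fun p : E 3 => p 0 := by ext; simp [axialField]
    simp only [Fin.mk_one, h, pd_coord]
    fin_cases a <;> simp
  · have h : axialField 2 = fun p : E 3 => 0 := by ext; simp [axialField]
    simp only [Fin.reduceFinMk, h, pd]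
    fin_cases a <;> simp

lemma lieDeriv_axialField (T : Tensor2 3) (a b : Fin 3) (p : E 3) :
    lieDeriv axialField T a b p = -p 1 * pd 0 (fun x => T x a b) p + p 0 * pd 1 (fun x => T x a b) p
      + ∑ c, (T p c b * (!![0, -1, 0; 1, 0, 0; 0, 0, 0] : Matrix (Fin 3) (Fin 3) ℝ) c a +
        T p a c * (!![0, -1, 0; 1, 0, 0; 0, 0, 0] : Matrix (Fin 3) (Fin 3) ℝ) c b) := by
  simp only [lieDeriv, pd_axialField]
  simp [Fin.sum_univ_three, axialField]
  ring

/-- The signs of the half turn about the `z`-axis. -/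
def axialSign : Fin 3 → ℝ := ![-1, -1, 1]

lemma axialSign_sq (i : Fin 3) : axialSign i * axialSign i = 1 := by
  fin_cases i <;> simp [axialSign]

/-- The half turn about the `z`-axis. -/
noncomputable abbrev halfTurn : E 3 →ₗᵢ[ℝ] E 3 := flip axialSign axialSign_sq

/-- The pullback of `T` under the rotation by `θ` has derivative zero in `θ`, since its Lie
derivative vanishes. `M` is a component of this pullback, compared at `θ = 0` and `θ = π`. -/
lemma apply_halfTurn {T : Tensor2 3} (hT : SmoothTensor T)
    (h : ∀ a b p, lieDeriv axialField T a b p = 0) (a b : Fin 3) (p : E 3) :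
    T (halfTurn p) a b = axialSign a * axialSign b * T p a b := by
  set J : ℝ → Matrix (Fin 3) (Fin 3) ℝ :=
    fun θ => !![Real.cos θ, -Real.sin θ, 0; Real.sin θ, Real.cos θ, 0; 0, 0, 1] with hJ
  set J' : ℝ → Matrix (Fin 3) (Fin 3) ℝ :=
    fun θ => !![-Real.sin θ, -Real.cos θ, 0; Real.cos θ, -Real.sin θ, 0; 0, 0, 0] with hJ'
  have dJ : ∀ θ c a, HasDerivAt (fun θ => J θ c a) (J' θ c a) θ := by
    intro θ c a
    have h1 := Real.hasDerivAt_cos θ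
    have h2 := Real.hasDerivAt_sin θ
    fin_cases c <;> fin_cases a <;> simp [hJ, hJ', h1, h2, h2.fun_neg, hasDerivAt_const]
  have dT : ∀ θ c d, HasDerivAt (fun θ => T (axialRotation θ p) c d)
      (-∑ e, (T (axialRotation θ p) e d *
          (!![0, -1, 0; 1, 0, 0; 0, 0, 0] : Matrix (Fin 3) (Fin 3) ℝ) e c +
        T (axialRotation θ p) c e *
          (!![0, -1, 0; 1, 0, 0; 0, 0, 0] : Matrix (Fin 3) (Fin 3) ℝ) e d)) θ := by
    intro θ c d
    have h1 := ((hT c d).differentiable_infty (axialRotation θ p)).hasFDerivAt.comp_hasDerivAt θ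
      (hasDerivAt_axialRotation θ p)
    refine h1.congr_deriv ?_
    have h2 := h c d (axialRotation θ p)
    rw [lieDeriv_axialField] at h2
    have h3 := congrFun (dirD_eq_sum (!₂[-axialRotation θ p 1, axialRotation θ p 0, 0] : E 3)
      (fun x => T x c d)) (axialRotation θ p)
    rw [dirD] at h3
    rw [h3]
    rw [Fin.sum_univ_three (f := fun i => (!₂[-axialRotation θ p 1, axialRotation θ p 0, 0] : E 3) i *
      pd i (fun x => T x c d) (axialRotation θ p))]
    simp only [Matrix.cons_val_zero, Matrix.cons_val_one, Matrix.cons_val]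
    linarith
  set M : ℝ → ℝ := fun θ => ∑ c, ∑ d, J θ c a * J θ d b * T (axialRotation θ p) c d with hM
  have dM : ∀ θ, HasDerivAt M 0 θ := by
    intro θ
    have h1 := HasDerivAt.fun_sum (u := Finset.univ) fun c _ =>
      HasDerivAt.fun_sum (u := Finset.univ) fun d _ =>
        ((dJ θ c a).fun_mul (dJ θ d b)).fun_mul (dT θ c d)
    refine h1.congr_deriv ?_
    simp only [hJ, hJ', Fin.sum_univ_three]
    fin_cases a <;> fin_cases b <;> simp <;> ring
  have hc : M Real.pi = M 0 :=
    is_const_of_deriv_eq_zero (fun θ => (dM θ).differentiableAt) (fun θ => (dM θ).deriv) _ _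
  have r0 : axialRotation 0 p = p := by
    ext i; fin_cases i <;> simp [axialRotation]
  have rpi : axialRotation Real.pi p = halfTurn p := by
    ext i
    rw [flip_apply]
    fin_cases i <;> simp [axialRotation, axialSign]
  simp only [hM, r0, rpi, hJ, Fin.sum_univ_three] at hc
  fin_cases a <;> fin_cases b <;> simp [axialSign] at hc ⊢ <;> linarith

/-- On the axis `η = 0` but `∂η ≠ 0`, so the Lie equation becomes algebraic in the components of
`T`. -/
lemma axis_values {T : Tensor2 3} (hs : ∀ p, (T p).IsSymm)
    (h : ∀ a b p, lieDeriv axialField T a b p = 0) {p : E 3} (h0 : p 0 = 0) (h1 : p 1 = 0) :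
    T p 0 1 = 0 ∧ T p 2 1 = 0 := by
  have e1 := h 0 0 p
  have e2 := h 2 0 p
  rw [lieDeriv_axialField] at e1 e2
  have := (hs p).apply 0 1
  simp [h0, h1, Fin.sum_univ_three] at e1 e2
  constructor <;> linarith

end Axisymmetric

end AxiGauge

namespace AxiGauge

open Filter Asymptotics Bornology MeasureTheory
open scoped Topology

/-! ### The maximum principle and the symmetry of the lapse -/

section MaxPrinciple

variable {n : ℕ}

/-- `A` is a sum of rank-one matrices `v vᵀ`, and each contributes a value of the quadratic form of
`P`. -/
lemma sum_mul_nonneg_of_posSemidef {A : Matrix (Fin n) (Fin n) ℝ} (hA : A.PosSemidef)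
    {P : Fin n → Fin n → ℝ} (hP : ∀ v : Fin n → ℝ, 0 ≤ ∑ a, ∑ b, v a * v b * P a b) :
    0 ≤ ∑ a, ∑ b, A a b * P a b := by
  obtain ⟨m, v, rfl⟩ := Matrix.posSemidef_iff_eq_sum_vecMulVec.1 hA
  have : ∑ a, ∑ b, (∑ k, Matrix.vecMulVec (v k) (star (v k))) a b * P a b =
      ∑ k, ∑ a, ∑ b, v k a * v k b * P a b := by
    simp only [Matrix.sum_apply, Matrix.vecMulVec_apply, star_trivial,
      Finset.sum_mul]
    rw [Finset.sum_comm (s := Finset.univ (α := Fin m))]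
    refine Finset.sum_congr rfl fun a _ => ?_
    rw [Finset.sum_comm]
  rw [this]
  exact Finset.sum_nonneg fun k _ => hP (v k)

lemma dirD_dirD_eq_sum {f : E n → ℝ} (hf : ContDiff ℝ ∞ f) (v : E n) (p : E n) :
    dirD v (dirD v f) p = ∑ a, ∑ b, v a * v b * pd a (pd b f) p := by
  rw [dirD_eq_sum v (dirD v f)]
  refine Finset.sum_congr rfl fun a _ => ?_
  rw [pd_eq_dirD, dirD_comm hf, dirD_eq_sum, Finset.mul_sum]
  refine Finset.sum_congr rfl fun b _ => ?_
  rw [pd_eq_dirD, dirD_comm hf]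
  simp only [pd_eq_dirD]
  ring

/-- A positive second derivative along the line would make the point a local minimum too, so the
function would be constant nearby, a contradiction. -/
lemma dirD_dirD_nonpos_of_isLocalMax {f : E n → ℝ} (hf : ContDiff ℝ ∞ f) {p : E n}
    (hp : IsLocalMax f p) (v : E n) : dirD v (dirD v f) p ≤ 0 := by
  set φ : ℝ → ℝ := fun t => f (p + t • v) with hφ
  have hl : ∀ t, HasDerivAt (fun t : ℝ => p + t • v) v t := by
    intro t
    simpa using ((hasDerivAt_id t).smul_const v).const_add p
  have d1 : ∀ t, HasDerivAt φ (dirD v f (p + t • v)) t := fun t =>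
    (hf.differentiable_infty _).hasFDerivAt.comp_hasDerivAt t (hl t)
  have d2 : ∀ t, HasDerivAt (fun t => dirD v f (p + t • v)) (dirD v (dirD v f) (p + t • v)) t :=
    fun t => ((contDiff_dirD hf v).differentiable_infty _).hasFDerivAt.comp_hasDerivAt t (hl t)
  have e1 : deriv φ = fun t => dirD v f (p + t • v) := funext fun t => (d1 t).deriv
  have e2 : deriv (deriv φ) 0 = dirD v (dirD v f) p := by
    rw [e1, (d2 0).deriv]; simp
  have hmax : IsLocalMax φ 0 := by
    have hc : ContinuousAt (fun t : ℝ => p + t • v) 0 := (hl 0).continuousAt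
    have h0 : p + (0 : ℝ) • v = p := by simp
    have h1 : Tendsto (fun t : ℝ => p + t • v) (𝓝 0) (𝓝 p) := by
      have := hc.tendsto
      rwa [h0] at this
    filter_upwards [h1.eventually hp] with t ht
    simpa [hφ] using ht
  by_contra! hpos
  rw [← e2] at hpos
  have hmin : IsLocalMin φ 0 :=
    isLocalMin_of_deriv_deriv_pos hpos hmax.deriv_eq_zero (d1 0).continuousAt
  have hconst : φ =ᶠ[𝓝 0] fun _ => φ 0 := by
    filter_upwards [hmax, hmin] with t h1 h2
    exact le_antisymm h1 h2
  have h3 : deriv (deriv φ) 0 = 0 := by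
    rw [hconst.deriv.deriv_eq]
    simp
  exact hpos.ne' h3

lemma laplacian_nonpos_of_isLocalMax {g : Tensor2 n} {f : E n → ℝ} (hf : ContDiff ℝ ∞ f) {p : E n}
    (hg : (g p).PosDef) (hp : IsLocalMax f p) : laplacian g f p ≤ 0 := by
  have h1 : ∀ c, pd c f p = 0 := by
    intro c
    rw [pd, hp.fderiv_eq_zero]
    simp
  have h2 := sum_mul_nonneg_of_posSemidef hg.inv.posSemidef (P := fun a b => -pd a (pd b f) p)
    (fun v => by
      have := dirD_dirD_nonpos_of_isLocalMax hf hp (WithLp.toLp 2 v)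
      rw [dirD_dirD_eq_sum hf] at this
      simp only [mul_neg, Finset.sum_neg_distrib]
      simpa using this)
  simp only [mul_neg, Finset.sum_neg_distrib] at h2
  simp only [laplacian, h1, mul_zero, Finset.sum_const_zero, sub_zero]
  linarith

lemma continuous_inv_apply {g : Tensor2 n} (hs : SmoothTensor g) (hg : ∀ p, (g p).PosDef)
    (a b : Fin n) : Continuous fun p => (g p)⁻¹ a b := by
  have hc : Continuous g := continuous_matrix fun a b => (hs a b).continuous
  have : (fun p => (g p)⁻¹ a b) = fun p => (g p).det⁻¹ * (g p).adjugate a b := by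
    ext p
    rw [Matrix.inv_def, Ring.inverse_eq_inv']
    rfl
  rw [this]
  exact (hc.matrix_det.inv₀ fun p => (hg p).det_pos.ne').mul (hc.matrix_adjugate.matrix_elem a b)

lemma continuous_christoffel {g : Tensor2 n} (hs : SmoothTensor g) (hg : ∀ p, (g p).PosDef)
    (c a b : Fin n) : Continuous (christoffel g c a b) := by
  have h : ∀ i a b, Continuous (pd i fun x => g x a b) := fun i a b =>
    (contDiff_dirD (hs a b) _).continuous
  unfold christoffel
  exact continuous_const.mul (continuous_finsetSum _ fun d _ =>
    (continuous_inv_apply hs hg c d).mul (((h _ _ _).add (h _ _ _)).sub (h _ _ _)))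

lemma pd_add {f g : E n → ℝ} (hf : Differentiable ℝ f) (hg : Differentiable ℝ g) (i : Fin n) :
    pd i (fun p => f p + g p) = fun p => pd i f p + pd i g p := dirD_add hf hg _

lemma pd_sub {f g : E n → ℝ} (hf : Differentiable ℝ f) (hg : Differentiable ℝ g) (i : Fin n) :
    pd i (fun p => f p - g p) = fun p => pd i f p - pd i g p := dirD_sub hf hg _

lemma differentiable_pd {f : E n → ℝ} (hf : ContDiff ℝ ∞ f) (i : Fin n) :
    Differentiable ℝ (pd i f) := (contDiff_dirD hf _).differentiable_infty

lemma laplacian_add_const_mul (g : Tensor2 n) {f h : E n → ℝ} (hf : ContDiff ℝ ∞ f)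
    (hh : ContDiff ℝ ∞ h) (c : ℝ) (p : E n) :
    laplacian g (fun x => f x + c * h x) p = laplacian g f p + c * laplacian g h p := by
  have e : ∀ i, pd i (fun x => f x + c * h x) = fun x => pd i f x + c * pd i h x := by
    intro i
    rw [pd_add hf.differentiable_infty (hh.differentiable_infty.const_mul c),
      pd_const_mul hh.differentiable_infty]
  have e2 : ∀ i j, pd i (fun x => pd j f x + c * pd j h x) =
      fun x => pd i (pd j f) x + c * pd i (pd j h) x := by
    intro i j
    rw [pd_add (differentiable_pd hf j) ((differentiable_pd hh j).const_mul c),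
      pd_const_mul (differentiable_pd hh j)]
  simp only [laplacian, e, e2, Finset.mul_sum]
  rw [← Finset.sum_add_distrib]
  refine Finset.sum_congr rfl fun a _ => ?_
  rw [← Finset.sum_add_distrib]
  refine Finset.sum_congr rfl fun b _ => ?_
  have : ∑ x, christoffel g x a b p * (pd x f p + c * pd x h p) =
      ∑ x, christoffel g x a b p * pd x f p + c * ∑ x, christoffel g x a b p * pd x h p := by
    rw [Finset.mul_sum, ← Finset.sum_add_distrib]
    exact Finset.sum_congr rfl fun x _ => by ring
  rw [this]
  ring

lemma pd_exp {u : E n → ℝ} (hu : Differentiable ℝ u) (i : Fin n) :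
    pd i (fun p => Real.exp (u p)) = fun p => Real.exp (u p) * pd i u p := by
  ext p
  rw [pd, ((hu p).hasFDerivAt.exp).fderiv]
  rfl

lemma laplacian_exp_coord (g : Tensor2 n) (i : Fin n) (L : ℝ) (p : E n) :
    laplacian g (fun p => Real.exp (L * p i)) p =
      Real.exp (L * p i) * (L * (L * (g p)⁻¹ i i - ∑ a, ∑ b, (g p)⁻¹ a b * christoffel g i a b p)) := by
  have hd : Differentiable ℝ fun p : E n => p i :=
    (EuclideanSpace.proj i : E n →L[ℝ] ℝ).differentiable
  have e : ∀ a, pd a (fun p : E n => Real.exp (L * p i)) =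
      fun p => (if i = a then L else 0) * Real.exp (L * p i) := by
    intro a
    rw [pd_exp (hd.const_mul L), pd_const_mul hd]
    ext p
    simp only [pd_coord]
    split_ifs <;> ring
  have e2 : ∀ a b, pd a (fun p : E n => (if i = b then L else 0) * Real.exp (L * p i)) =
      fun p => (if i = b then L else 0) * ((if i = a then L else 0) * Real.exp (L * p i)) := by
    intro a b
    rw [pd_const_mul ((hd.const_mul L).exp), e]
  simp only [laplacian, e, e2]
  simp only [ite_mul, zero_mul, mul_ite, mul_zero, Finset.sum_ite_eq, Finset.mem_univ, if_true,
    mul_sub, Finset.sum_sub_distrib]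
  congr 1
  · ring_nf
    simp
    ring
  · simp only [Finset.mul_sum]
    exact Finset.sum_congr rfl fun a _ => Finset.sum_congr rfl fun b _ => by ring

/-- The weak maximum principle for `Δ_g w = c w` with `c ≥ 0`. -/
lemma nonpos_of_laplacian_eq {g : Tensor2 n} (hs : SmoothTensor g) (hg : ∀ p, (g p).PosDef)
    (i : Fin n) {w c : E n → ℝ} (hw : ContDiff ℝ ∞ w) (hc : ∀ p, 0 ≤ c p)
    (heq : ∀ p, laplacian g w p = w p * c p) (h0 : Tendsto w (cobounded (E n)) (𝓝 0)) (p₀ : E n) :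
    w p₀ ≤ 0 := by
  by_contra! hm
  set m := w p₀ with hmdef
  obtain ⟨R, hR⟩ : ∃ R, ∀ p : E n, R ≤ ‖p‖ → w p < m / 4 := by
    have := h0.eventually (gt_mem_nhds (show (0 : ℝ) < m / 4 by positivity))
    rw [(Metric.hasBasis_cobounded_compl_closedBall (0 : E n)).eventually_iff] at this
    obtain ⟨R, -, hR⟩ := this
    exact ⟨R + 1, fun p hp => hR (x := p) (by
      have : R < ‖p‖ := by linarith
      simpa using this)⟩
  have hp0 : ‖p₀‖ < R := by
    by_contra! h
    have := hR p₀ h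
    linarith
  set b : E n → ℝ := fun p => ∑ a, ∑ b, (g p)⁻¹ a b * christoffel g i a b p
  have hpos : ∀ p, 0 < (g p)⁻¹ i i := fun p => (hg p).inv.diag_pos
  have cb : Continuous fun p => b p / (g p)⁻¹ i i :=
    (continuous_finsetSum _ fun a _ => continuous_finsetSum _ fun b _ =>
      (continuous_inv_apply hs hg a b).mul (continuous_christoffel hs hg i a b)).div
      (continuous_inv_apply hs hg i i) fun p => (hpos p).ne'
  have hK : IsCompact (Metric.closedBall (0 : E n) R) := isCompact_closedBall _ _
  obtain ⟨C, hC⟩ := hK.exists_bound_of_continuousOn cb.continuousOn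
  -- `L` beats the first-order coefficient on the ball, so the barrier `e = exp (L x_i)` has
  -- positive Laplacian there, and `ε` keeps `ε e ≤ m / 4`. A maximum of `w + ε e` then has `w ≥
  -- 3m/4`, so it is not on the sphere, where `w < m / 4`. In the interior the Laplacian would be
  -- both nonpositive and positive.
  set L := |C| + 1 with hL
  have L0 : 0 < L := by positivity
  set ε := m / (4 * Real.exp (L * R)) with hε
  have ε0 : 0 < ε := by positivity
  set e : E n → ℝ := fun p => Real.exp (L * p i)
  have he : ContDiff ℝ ∞ e :=
    (contDiff_const.mul (EuclideanSpace.proj i : E n →L[ℝ] ℝ).contDiff).exp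
  have hF : ContDiff ℝ ∞ fun p => w p + ε * e p := hw.add (contDiff_const.mul he)
  obtain ⟨p₁, hp₁, hmax⟩ := hK.exists_isMaxOn ⟨p₀, by simpa using hp0.le⟩ hF.continuous.continuousOn
  have hbig : m ≤ w p₁ + ε * e p₁ := by
    have h1 := hmax (show p₀ ∈ Metric.closedBall (0 : E n) R by simpa using hp0.le)
    have h2 : 0 < ε * e p₀ := by positivity
    simp only [Set.mem_ofPred_eq] at h1
    linarith
  have hp₁R : ‖p₁‖ ≤ R := by simpa using hp₁
  have hsmall : ε * e p₁ ≤ m / 4 := by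
    have h1 : e p₁ ≤ Real.exp (L * R) := by
      refine Real.exp_le_exp.2 (mul_le_mul_of_nonneg_left ?_ L0.le)
      have := PiLp.norm_apply_le p₁ i
      rw [Real.norm_eq_abs] at this
      linarith [le_abs_self (p₁ i)]
    calc ε * e p₁ ≤ ε * Real.exp (L * R) := by gcongr
      _ = m / 4 := by rw [hε]; field_simp
  have hlt : ‖p₁‖ < R := by
    refine lt_of_le_of_ne hp₁R fun h => ?_
    have := hR p₁ h.ge
    linarith
  have hloc : IsLocalMax (fun p => w p + ε * e p) p₁ := by
    refine hmax.isLocalMax ?_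
    refine mem_of_superset (Metric.isOpen_ball.mem_nhds (x := p₁) ?_) Metric.ball_subset_closedBall
    simpa using hlt
  have hlap := laplacian_nonpos_of_isLocalMax hF (hg p₁) hloc
  rw [laplacian_add_const_mul g hw he, heq, laplacian_exp_coord] at hlap
  have h1 : 0 ≤ w p₁ * c p₁ := mul_nonneg (by linarith) (hc _)
  have h2 : b p₁ < L * (g p₁)⁻¹ i i := by
    rw [← div_lt_iff₀ (hpos p₁)]
    have := hC p₁ hp₁
    rw [Real.norm_eq_abs] at this
    linarith [le_abs_self (b p₁ / (g p₁)⁻¹ i i), le_abs_self C]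
  have h3 : 0 < ε * (Real.exp (L * p₁ i) * (L * (L * (g p₁)⁻¹ i i - b p₁))) := by
    have : 0 < L * (g p₁)⁻¹ i i - b p₁ := by linarith
    positivity
  linarith

end MaxPrinciple

/-! ### Invariance of the lapse under the half turn -/

section LapseSymmetry

variable {n : ℕ} {s : Fin n → ℝ} {hs : ∀ i, s i * s i = 1}

lemma inv_flip {g : Tensor2 n} (h : ∀ a b p, g (flip s hs p) a b = s a * s b * g p a b)
    (a b : Fin n) (p : E n) : (g (flip s hs p))⁻¹ a b = s a * s b * (g p)⁻¹ a b := by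
  have h1 : g (flip s hs p) = Matrix.diagonal s * g p * Matrix.diagonal s := by
    ext a b
    rw [h, Matrix.mul_diagonal, Matrix.diagonal_mul]
    ring
  have h2 : (Matrix.diagonal s)⁻¹ = Matrix.diagonal s := by
    refine Matrix.inv_eq_left_inv ?_
    rw [Matrix.diagonal_mul_diagonal]
    simp [hs]
  rw [h1, Matrix.mul_inv_rev, Matrix.mul_inv_rev, h2, Matrix.diagonal_mul, Matrix.mul_diagonal]
  ring

lemma pd_tensor_flip {g : Tensor2 n} (hg : SmoothTensor g)
    (h : ∀ a b p, g (flip s hs p) a b = s a * s b * g p a b) (i a b : Fin n) (p : E n) :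
    pd i (fun x => g x a b) (flip s hs p) = s i * s a * s b * pd i (fun x => g x a b) p := by
  have h1 := congrFun (pd_comp_flip (hs := hs) (hg a b).differentiable_infty i) p
  simp only [h] at h1
  rw [pd_const_mul (hg a b).differentiable_infty] at h1
  simp only at h1
  linear_combination (-s i) * h1 - pd i (fun x => g x a b) (flip s hs p) * hs i

lemma christoffel_flip {g : Tensor2 n} (hg : SmoothTensor g)
    (h : ∀ a b p, g (flip s hs p) a b = s a * s b * g p a b) (c a b : Fin n) (p : E n) :
    christoffel g c a b (flip s hs p) = s c * s a * s b * christoffel g c a b p := by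
  simp only [christoffel, inv_flip h, pd_tensor_flip hg h, Finset.mul_sum]
  refine Finset.sum_congr rfl fun d _ => ?_
  linear_combination (1 / 2 * s c * s a * s b * (g p)⁻¹ c d *
    (pd a (fun x => g x d b) p + pd b (fun x => g x d a) p - pd d (fun x => g x a b) p)) * hs d

lemma laplacian_comp_flip {g : Tensor2 n} (hg : SmoothTensor g)
    (h : ∀ a b p, g (flip s hs p) a b = s a * s b * g p a b) {f : E n → ℝ} (hf : ContDiff ℝ ∞ f)
    (p : E n) : laplacian g (fun x => f (flip s hs x)) p = laplacian g f (flip s hs p) := by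
  have e : ∀ a b, pd a (fun p => s b * pd b f (flip s hs p)) =
      fun p => s b * (s a * pd a (pd b f) (flip s hs p)) := by
    intro a b
    have hd : Differentiable ℝ fun p => pd b f (flip s hs p) :=
      (differentiable_pd hf b).comp (flip s hs).toContinuousLinearMap.differentiable
    rw [pd_const_mul hd, pd_comp_flip (differentiable_pd hf b)]
  simp only [laplacian, pd_comp_flip hf.differentiable_infty, e, inv_flip h, christoffel_flip hg h]
  refine Finset.sum_congr rfl fun a _ => Finset.sum_congr rfl fun b _ => ?_
  have : ∑ c, s c * s a * s b * christoffel g c a b p * pd c f (flip s hs p) =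
      s a * s b * ∑ c, christoffel g c a b p * (s c * pd c f (flip s hs p)) := by
    rw [Finset.mul_sum]
    exact Finset.sum_congr rfl fun c _ => by ring
  rw [this]
  linear_combination (g p)⁻¹ a b * (∑ c, christoffel g c a b p * (s c * pd c f (flip s hs p))) *
    (s b * s b * hs a + hs b)

/-- Positivity of `γ⁻¹` is used twice, once for each pair of contracted indices. This is the sign
the maximum principle requires. -/
lemma curvSq_nonneg {γ K : Tensor2 3} (hγ : ∀ p, (γ p).PosDef) (p : E 3) : 0 ≤ curvSq γ K p := by
  have hA := (hγ p).inv.posSemidef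
  have hq : ∀ x : Fin 3 → ℝ, 0 ≤ ∑ a, ∑ c, (γ p)⁻¹ a c * (x a * x c) := fun x =>
    sum_mul_nonneg_of_posSemidef hA fun v => by
      have : ∑ a, ∑ b, v a * v b * (x a * x b) = (∑ a, v a * x a) * ∑ b, v b * x b := by
        rw [Finset.sum_mul_sum]
        exact Finset.sum_congr rfl fun a _ => Finset.sum_congr rfl fun b _ => by ring
      rw [this]
      exact mul_self_nonneg _
  have := sum_mul_nonneg_of_posSemidef hA
    (P := fun b d => ∑ a, ∑ c, (γ p)⁻¹ a c * (K p a b * K p c d)) fun v => by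
      refine (hq fun a => ∑ b, K p a b * v b).trans_eq ?_
      simp only [Fin.sum_univ_three]
      ring
  refine this.trans_eq ?_
  simp only [curvSq, Fin.sum_univ_three]
  ring

/-- The rotated lapse solves the same equation with the same limit at infinity, and the maximum
principle compares the two in both directions. -/
lemma lapse_halfTurn {γ K : Tensor2 3} {α : E 3 → ℝ} (hdata : IsAxisymAFData γ K)
    (hα : IsMaximalLapse γ K α) (p : E 3) : α (halfTurn p) = α p := by
  have hγ := apply_halfTurn hdata.smooth_metric hdata.killing_metric
  have hK := apply_halfTurn hdata.smooth_curv hdata.killing_curv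
  have hcurv : ∀ p, curvSq γ K (halfTurn p) = curvSq γ K p := by
    intro p
    simp only [curvSq, inv_flip (fun a b p => hγ a b p), hK]
    refine Finset.sum_congr rfl fun a _ => Finset.sum_congr rfl fun b _ =>
      Finset.sum_congr rfl fun c _ => Finset.sum_congr rfl fun d _ => ?_
    have ha := axialSign_sq a
    have hb := axialSign_sq b
    have hc := axialSign_sq c
    have hd := axialSign_sq d
    calc _ = (axialSign a * axialSign a) * (axialSign b * axialSign b) *
          (axialSign c * axialSign c) * (axialSign d * axialSign d) *
          ((γ p)⁻¹ a c * (γ p)⁻¹ b d * K p a b * K p c d) := by ring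
      _ = _ := by rw [ha, hb, hc, hd]; ring
  have hdec := hα.decay.decays (hα.smooth.sub contDiff_const)
  have hflip : ContDiff ℝ ∞ fun x => α (halfTurn x) :=
    hα.smooth.comp halfTurn.toContinuousLinearMap.contDiff
  have hdec2 := hdec.comp_isometry halfTurn
  have main : ∀ f h : E 3 → ℝ, ContDiff ℝ ∞ f → ContDiff ℝ ∞ h →
      (∀ p, laplacian γ f p = f p * curvSq γ K p) → (∀ p, laplacian γ h p = h p * curvSq γ K p) →
      Tendsto (fun p => f p - 1) (cobounded (E 3)) (𝓝 0) →
      Tendsto (fun p => h p - 1) (cobounded (E 3)) (𝓝 0) → ∀ p, f p ≤ h p := by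
    intro f h hf hh ef eh tf th p
    have ht : Tendsto (fun p => f p + (-1) * h p) (cobounded (E 3)) (𝓝 0) := by
      have := tf.sub th
      rw [sub_zero] at this
      refine this.congr fun p => by ring
    have := nonpos_of_laplacian_eq hdata.smooth_metric hdata.posDef_metric 0
      (hf.add (contDiff_const.mul hh)) (curvSq_nonneg (K := K) hdata.posDef_metric)
      (fun p => by rw [laplacian_add_const_mul γ hf hh, ef, eh]; ring) ht p
    linarith
  have ef := hα.eqn
  have eh : ∀ p, laplacian γ (fun x => α (halfTurn x)) p = α (halfTurn p) * curvSq γ K p := by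
    intro p
    rw [laplacian_comp_flip hdata.smooth_metric (fun a b p => hγ a b p) hα.smooth, ef, hcurv]
  have tf := hdec.tendsto_zero (by norm_num)
  have th := hdec2.tendsto_zero (by norm_num)
  exact le_antisymm (main _ _ hflip hα.smooth eh ef th tf p) (main _ _ hα.smooth hflip ef eh tf th p)

end LapseSymmetry

end AxiGauge

namespace AxiGauge

open Filter Asymptotics Bornology MeasureTheory
open scoped Topology

/-! ### The quotient fields on the meridian plane -/

section Meridian

/-- The embedding of the meridian plane as a linear isometry. -/
noncomputable def meridianIsometry : E 2 →ₗᵢ[ℝ] E 3 where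
  toFun := meridian
  map_add' p q := by ext i; fin_cases i <;> simp [meridian]
  map_smul' c p := by ext i; fin_cases i <;> simp [meridian]
  norm_map' p := by simp [meridian, EuclideanSpace.norm_eq, Fin.sum_univ_three]

lemma Decays.comp_meridian {k : ℝ} {f : E 3 → ℝ} (hf : Decays k f) :
    Decays k fun p => f (meridian p) := hf.comp_isometry meridianIsometry

lemma lower_axialField_meridian (γ : Tensor2 3) (a : Fin 3) (p : E 2) :
    lower γ axialField a (meridian p) = γ (meridian p) a 1 * p 0 := by
  simp [lower, axialField, meridian, Fin.sum_univ_three]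

lemma normSqAxial_meridian (γ : Tensor2 3) (p : E 2) :
    normSqAxial γ (meridian p) = γ (meridian p) 1 1 * (p 0 * p 0) := by
  simp [normSqAxial, axialField, meridian, Fin.sum_univ_three]
  ring

/-- The coefficient `γ_{a y} / γ_{y y}` of the projection along the meridian plane. -/
noncomputable def shear (γ : Tensor2 3) (a : Fin 2) (p : E 2) : ℝ :=
  γ (meridian p) (meridianIndex a) 1 * (γ (meridian p) 1 1)⁻¹

lemma meridianIndex_zero : meridianIndex 0 = 0 := rfl

lemma meridianIndex_one : meridianIndex 1 = 2 := rfl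

variable {γ K : Tensor2 3}

lemma metric_yy_pos (h : IsAxisymAFData γ K) (p : E 3) : 0 < γ p 1 1 := (h.posDef_metric p).diag_pos

lemma metric_symm (h : IsAxisymAFData γ K) (p : E 3) : (γ p).IsSymm := by
  have := (h.posDef_metric p).isHermitian
  rwa [Matrix.IsHermitian, Matrix.conjTranspose_eq_transpose_of_trivial] at this

lemma shear_eq_zero (h : IsAxisymAFData γ K) (a : Fin 2) {p : E 2} (hp : p 0 = 0) :
    shear γ a p = 0 := by
  obtain ⟨h1, h2⟩ := axis_values (metric_symm h) h.killing_metric (p := meridian p)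
    (by simp [meridian, hp]) (by simp [meridian])
  fin_cases a <;> simp [shear, meridianIndex, h1, h2]

/-- The powers of `ρ` cancel, so the projection is smooth across the axis. There the convention `0 /
0 = 0` gives the right value, because `shear` vanishes. -/
lemma lower_div_normSq (h : IsAxisymAFData γ K) (a : Fin 2) (p : E 2) :
    p 0 * lower γ axialField (meridianIndex a) (meridian p) / normSqAxial γ (meridian p) =
      shear γ a p := by
  rw [lower_axialField_meridian, normSqAxial_meridian]
  by_cases hp : p 0 = 0
  · rw [shear_eq_zero h a hp, hp]; simp
  · have := (metric_yy_pos h (meridian p)).ne'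
    rw [shear]
    field_simp

lemma qMetric_eq (h : IsAxisymAFData γ K) (a b : Fin 2) (p : E 2) :
    qMetric γ p a b = γ (meridian p) (meridianIndex a) (meridianIndex b) -
      shear γ a p * γ (meridian p) (meridianIndex b) 1 := by
  rw [← lower_div_normSq h a p]
  simp only [qMetric, restrict, quotientMetric3, Matrix.of_apply]
  rw [lower_axialField_meridian γ (meridianIndex b)]
  ring

lemma proj_meridian (h : IsAxisymAFData γ K) (c : Fin 3) (a : Fin 2) (p : E 2) :
    proj γ c (meridianIndex a) (meridian p) =
      (1 : Matrix (Fin 3) (Fin 3) ℝ) c (meridianIndex a) - if c = 1 then shear γ a p else 0 := by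
  rw [← lower_div_normSq h a p, proj]
  congr 1
  fin_cases c <;> simp [axialField, meridian]

lemma chi_eq (h : IsAxisymAFData γ K) (a b : Fin 2) (p : E 2) :
    chi γ K p a b = K (meridian p) (meridianIndex a) (meridianIndex b) -
      shear γ a p * K (meridian p) 1 (meridianIndex b) -
      shear γ b p * K (meridian p) (meridianIndex a) 1 +
      shear γ a p * shear γ b p * K (meridian p) 1 1 := by
  simp only [chi, restrict, quotientCurv3, Matrix.of_apply, proj_meridian h, Fin.sum_univ_three]
  obtain rfl | rfl := Fin.exists_fin_two.1 ⟨a, rfl⟩ <;>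
  obtain rfl | rfl := Fin.exists_fin_two.1 ⟨b, rfl⟩ <;>
  simp [meridianIndex_zero, meridianIndex_one, Matrix.one_apply] <;> ring

lemma chi_symm (h : IsAxisymAFData γ K) (a b : Fin 2) (p : E 2) :
    chi γ K p a b = chi γ K p b a := by
  rw [chi_eq h, chi_eq h, (h.symm_curv (meridian p)).apply (meridianIndex b) (meridianIndex a),
    (h.symm_curv (meridian p)).apply 1 (meridianIndex b),
    (h.symm_curv (meridian p)).apply 1 (meridianIndex a)]
  ring

/-- The signs of the reflection of the meridian plane. -/
def rhoSign : Fin 2 → ℝ := ![-1, 1]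

lemma rhoSign_sq (i : Fin 2) : rhoSign i * rhoSign i = 1 := by
  fin_cases i <;> simp [rhoSign]

lemma reflect_eq_flip (p : E 2) : reflect p = flip rhoSign rhoSign_sq p := by
  ext i
  rw [flip_apply]
  fin_cases i <;> simp [reflect, rhoSign]

lemma meridian_reflect (p : E 2) : meridian (reflect p) = halfTurn (meridian p) := by
  ext i
  rw [flip_apply]
  fin_cases i <;> simp [reflect, meridian, axialSign]

lemma axialSign_meridianIndex (a : Fin 2) : axialSign (meridianIndex a) = rhoSign a := by
  fin_cases a <;> simp [axialSign, meridianIndex, rhoSign]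

lemma axialSign_one : axialSign 1 = -1 := by simp [axialSign]

lemma shear_reflect (h : IsAxisymAFData γ K) (a : Fin 2) (p : E 2) :
    shear γ a (reflect p) = -rhoSign a * shear γ a p := by
  simp only [shear, meridian_reflect, apply_halfTurn h.smooth_metric h.killing_metric,
    axialSign_meridianIndex, axialSign_one]
  ring

lemma qMetric_reflect (h : IsAxisymAFData γ K) (a b : Fin 2) (p : E 2) :
    qMetric γ (reflect p) a b = rhoSign a * rhoSign b * qMetric γ p a b := by
  simp only [qMetric_eq h, shear_reflect h, meridian_reflect,
    apply_halfTurn h.smooth_metric h.killing_metric, axialSign_meridianIndex, axialSign_one]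
  ring

lemma chi_reflect (h : IsAxisymAFData γ K) (a b : Fin 2) (p : E 2) :
    chi γ K (reflect p) a b = rhoSign a * rhoSign b * chi γ K p a b := by
  simp only [chi_eq h, shear_reflect h, meridian_reflect,
    apply_halfTurn h.smooth_curv h.killing_curv, axialSign_meridianIndex, axialSign_one]
  ring

lemma Decays.mul_of_sub_one {V : Type*} [NormedAddCommGroup V] [NormedSpace ℝ V] {k m : ℝ}
    (hk : k ≤ 0) {f g : V → ℝ} (hf : Decays k fun x => f x - 1) (hg : Decays m g) :
    Decays m fun x => f x * g x := by
  have := hg.add ((hf.mul hg).mono (k' := m) (by linarith))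
  refine (congrArg (Decays m) ?_).mp this
  ext x; ring

lemma Decays.inv_sub_one {V : Type*} [NormedAddCommGroup V] [NormedSpace ℝ V] {k : ℝ}
    (hk : k ≤ 0) {f : V → ℝ} (hf : Decays k fun x => f x - 1) (h0 : ∀ x, f x ≠ 0) :
    Decays k fun x => (f x)⁻¹ - 1 := by
  have := hf.one_add_inv hk (by simpa using h0)
  simpa using this

lemma decays_metric_meridian (h : IsAxisymAFData γ K) (a b : Fin 3) :
    Decays (-1 / 2) fun p => γ (meridian p) a b - (1 : Matrix (Fin 3) (Fin 3) ℝ) a b :=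
  ((h.flat_metric a b).decays ((h.smooth_metric a b).sub contDiff_const)).comp_meridian

lemma decays_curv_meridian (h : IsAxisymAFData γ K) (a b : Fin 3) :
    Decays (-3 / 2) fun p => K (meridian p) a b :=
  ((h.flat_curv a b).decays (h.smooth_curv a b)).comp_meridian

lemma decays_shear (h : IsAxisymAFData γ K) (a : Fin 2) : Decays (-1 / 2) (shear γ a) := by
  have h1 : Decays (-1 / 2) fun p => (γ (meridian p) 1 1)⁻¹ - 1 := by
    refine Decays.inv_sub_one (by norm_num) ?_ fun p => (metric_yy_pos h _).ne'
    simpa using decays_metric_meridian h 1 1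
  have h2 : Decays (-1 / 2) fun p => γ (meridian p) (meridianIndex a) 1 := by
    have := decays_metric_meridian h (meridianIndex a) 1
    obtain rfl | rfl := Fin.exists_fin_two.1 ⟨a, rfl⟩ <;>
    simpa [meridianIndex_zero, meridianIndex_one, Matrix.one_apply] using this
  refine (congrArg (Decays (-1 / 2)) ?_).mp (h1.mul_of_sub_one (by norm_num) h2)
  ext p
  rw [shear, mul_comm]

lemma decays_chi (h : IsAxisymAFData γ K) (a b : Fin 2) :
    Decays (-3 / 2) fun p => chi γ K p a b := by
  have hK := decays_curv_meridian h
  have hs := decays_shear h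
  have hsK : ∀ a i j, Decays (-3 / 2) fun p => shear γ a p * K (meridian p) i j := fun a i j =>
    ((hs a).mul (hK i j)).mono (by norm_num)
  have hssK := ((hs a).mul (hsK b 1 1)).mono (k' := -3 / 2) (by norm_num)
  have := (((hK (meridianIndex a) (meridianIndex b)).sub (hsK a 1 (meridianIndex b))).sub
    (hsK b (meridianIndex a) 1)).add hssK
  refine (congrArg (Decays (-3 / 2)) ?_).mp this
  ext p
  rw [chi_eq h, mul_assoc]

lemma decays_qMetric_sub_one (h : IsAxisymAFData γ K) :
    Decays (-1 / 2) fun p => qMetric γ p 0 0 - 1 := by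
  have h1 : Decays (-1 / 2) fun p => γ (meridian p) 0 1 := by
    simpa using decays_metric_meridian h 0 1
  have h2 : Decays (-1 / 2) fun p => γ (meridian p) 0 0 - 1 := by
    simpa using decays_metric_meridian h 0 0
  have := h2.sub (((decays_shear h 0).mul h1).mono (k' := -1 / 2) (by norm_num))
  refine (congrArg (Decays (-1 / 2)) ?_).mp this
  ext p
  rw [qMetric_eq h]
  simp [meridianIndex]
  ring

end Meridian

/-! ### Trace-free part and conformal Killing operator in isothermal coordinates -/

section Isothermal

variable {γ K : Tensor2 3} {w : E 2 → ℝ}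

/-- In isothermal coordinates with conformal factor `w`, the components of `k`. -/
lemma kLow_isothermal (hw : ∀ p, w p ≠ 0)
    (hq : ∀ p, qMetric γ p = w p • (1 : Matrix (Fin 2) (Fin 2) ℝ)) (a b : Fin 2) (p : E 2) :
    kLow γ K p a b = chi γ K p a b -
      (1 : Matrix (Fin 2) (Fin 2) ℝ) a b * (chi γ K p 0 0 + chi γ K p 1 1) / 2 := by
  have hinv : (w p • (1 : Matrix (Fin 2) (Fin 2) ℝ))⁻¹ = (w p)⁻¹ • 1 := by
    refine Matrix.inv_eq_left_inv ?_
    rw [smul_mul_smul_comm, inv_mul_cancel₀ (hw p)]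
    simp
  have := hw p
  simp only [kLow, chiTrace, Matrix.of_apply, hq, hinv, Fin.sum_univ_two]
  simp
  field_simp

lemma kMixed_isothermal (hw : ∀ p, w p ≠ 0)
    (hq : ∀ p, qMetric γ p = w p • (1 : Matrix (Fin 2) (Fin 2) ℝ)) (a b : Fin 2) (p : E 2) :
    kMixed γ K a b p = (w p)⁻¹ * kLow γ K p a b := by
  have hinv : (w p • (1 : Matrix (Fin 2) (Fin 2) ℝ))⁻¹ = (w p)⁻¹ • 1 := by
    refine Matrix.inv_eq_left_inv ?_
    rw [smul_mul_smul_comm, inv_mul_cancel₀ (hw p)]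
    simp
  simp only [kMixed, hq, hinv, Fin.sum_univ_two]
  fin_cases a <;> simp

/-- The conformal Killing operator of a conformally flat metric. -/
lemma conformalKilling_isothermal {q : Tensor2 2} (hw : ∀ p, w p ≠ 0) (hws : Differentiable ℝ w)
    (hq : ∀ p, q p = w p • (1 : Matrix (Fin 2) (Fin 2) ℝ)) {β : Fin 2 → E 2 → ℝ}
    (hβ : ∀ a, Differentiable ℝ (β a)) (a b : Fin 2) (p : E 2) :
    conformalKilling q β a b p = w p * (pd a (β b) p + pd b (β a) p -
      (1 : Matrix (Fin 2) (Fin 2) ℝ) a b * (pd 0 (β 0) p + pd 1 (β 1) p)) := by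
  have hinv : (q p)⁻¹ = (w p)⁻¹ • 1 := by
    rw [hq]
    refine Matrix.inv_eq_left_inv ?_
    rw [smul_mul_smul_comm, inv_mul_cancel₀ (hw p)]
    simp
  have hpq : ∀ i a b, pd i (fun x => q x a b) p = (1 : Matrix (Fin 2) (Fin 2) ℝ) a b * pd i w p := by
    intro i a b
    have : (fun x => q x a b) = fun x => (1 : Matrix (Fin 2) (Fin 2) ℝ) a b * w x := by
      ext x; rw [hq]; simp [mul_comm]
    rw [this, pd_const_mul hws]
  have hl : ∀ a, lower q β a = fun x => w x * β a x := by
    intro a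
    ext x
    simp only [lower, hq, Fin.sum_univ_two]
    fin_cases a <;> simp
  have hpl : ∀ i a, pd i (lower q β a) p = w p * pd i (β a) p + pd i w p * β a p := by
    intro i a
    rw [hl, pd_eq_dirD, dirD_mul hws (hβ a)]
    rfl
  have := hw p
  -- All derivatives of `w` cancel: on contravariant fields the operator is conformally covariant.
  simp only [conformalKilling, covDeriv, divergence, christoffel, hpl, hinv, hpq, Fin.sum_univ_two]
  simp only [hl, hq]
  obtain rfl | rfl := Fin.exists_fin_two.1 ⟨a, rfl⟩ <;>
  obtain rfl | rfl := Fin.exists_fin_two.1 ⟨b, rfl⟩ <;> simp <;> field_simp <;> ring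

end Isothermal

/-! ### From the first-order system to shift solutions, and uniqueness -/

section Shift

variable {γ K : Tensor2 3} {α : E 3 → ℝ}

/-- The component form of the first-order gauge equations suffices for the second-order ones. -/
lemma isShiftSolution_of_cauchyRiemann {a b : E 2 → ℝ} (ha : ContDiff ℝ ∞ a)
    (hb : ContDiff ℝ ∞ b) (h00 : ∀ p, α (meridian p) * kMixed γ K 0 0 p = a p)
    (h01 : ∀ p, α (meridian p) * kMixed γ K 0 1 p = b p)
    (h10 : ∀ p, α (meridian p) * kMixed γ K 1 0 p = b p)
    (h11 : ∀ p, α (meridian p) * kMixed γ K 1 1 p = -1 * a p) {β : Fin 2 → E 2 → ℝ}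
    (hβ : ∀ i, Decays (-1 / 2) (β i)) (h1 : ∀ p, pd 0 (β 0) p - pd 1 (β 1) p = 2 * a p)
    (h2 : ∀ p, pd 1 (β 0) p + pd 0 (β 1) p = 2 * b p) : IsShiftSolution γ K α β where
  smooth i := (hβ i).1
  decay i := (hβ i).isLittleOInfty
  eqn i p := by
    obtain ⟨e1, e2⟩ := laplace_of_cauchyRiemann (hβ 0).1 (hβ 1).1 ha hb h1 h2 p
    have ea := pd_const_mul ha.differentiable_infty (-1)
    fin_cases i
    · simp only [Fin.sum_univ_two, Fin.zero_eta, h00, h01, e1]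
    · simp only [Fin.sum_univ_two, Fin.mk_one, h10, h11, e2, ea]
      ring

lemma IsShiftSolution.decays {β : Fin 2 → E 2 → ℝ} (h : IsShiftSolution γ K α β) (i : Fin 2) :
    Decays (-1 / 2) (β i) := (h.decay i).decays (h.smooth i)

lemma IsShiftSolution.unique {β β' : Fin 2 → E 2 → ℝ} (h : IsShiftSolution γ K α β)
    (h' : IsShiftSolution γ K α β') : β' = β := by
  funext i
  have hd := (h'.decays i).sub (h.decays i)
  have e : ∀ j, pd j (pd j fun x => β' i x - β i x) =
      fun x => pd j (pd j (β' i)) x - pd j (pd j (β i)) x := by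
    intro j
    rw [pd_sub (h'.smooth i).differentiable_infty (h.smooth i).differentiable_infty,
      pd_sub (differentiable_pd (h'.smooth i) j) (differentiable_pd (h.smooth i) j)]
  have := eq_zero_of_harmonic hd fun p => by
    rw [e, e]
    have e1 := h.eqn i p
    have e2 := h'.eqn i p
    rw [← e1, Fin.sum_univ_two, Fin.sum_univ_two] at e2
    linarith
  funext p
  exact sub_eq_zero.1 (congrFun this p)

end Shift

end AxiGauge

/-! ### Existence, parity, gauge equation and regularity on the axis -/

open AxiGauge
theorem theorem2 (γ K : Tensor2 3) (α : E 3 → ℝ)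
    (hdata : IsAxisymAFData γ K) (hiso : IsIsothermal γ) (hα : IsMaximalLapse γ K α) :
    ∃ β : Fin 2 → E 2 → ℝ,
      IsShiftSolution γ K α β ∧
      (∀ β' : Fin 2 → E 2 → ℝ, IsShiftSolution γ K α β' → β' = β) ∧
      (∀ p, β 0 (reflect p) = -β 0 p) ∧
      (∀ p, β 1 (reflect p) = β 1 p) ∧
      (∀ a b p, conformalKilling (qMetric γ) β a b p = 2 * α (meridian p) * kLow γ K p a b) ∧
      ∃ g : E 2 → ℝ, ContDiff ℝ ∞ g ∧ (∀ p, p 0 ≠ 0 → g p = β 0 p / p 0) ∧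
        IsLittleOInfty (-3 / 2) g := by
  obtain ⟨u, hu, hqu⟩ := hiso
  set w : E 2 → ℝ := fun p => Real.exp (2 * u p)
  have hw : ∀ p, w p ≠ 0 := fun p => (Real.exp_pos _).ne'
  have hws : ContDiff ℝ ∞ w := (contDiff_const.mul hu).exp
  have hq : ∀ p, qMetric γ p = w p • (1 : Matrix (Fin 2) (Fin 2) ℝ) := by
    intro p; ext a b; rw [hqu]; rfl
  have hq00 : ∀ p, qMetric γ p 0 0 = w p := by intro p; rw [hq]; simp
  -- No decay of `u` is assumed; it comes from the asymptotic flatness of `γ` through `q_ρρ = w`.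
  have dw : Decays (-1 / 2) fun p => (w p)⁻¹ - 1 := by
    refine Decays.inv_sub_one (by norm_num) ?_ hw
    simpa only [hq00] using decays_qMetric_sub_one hdata
  have dα : Decays (-1 / 2) fun p => α (meridian p) - 1 :=
    (hα.decay.decays (hα.smooth.sub contDiff_const)).comp_meridian
  have dk : ∀ f : E 2 → ℝ, Decays (-3 / 2) f →
      Decays (-3 / 2) fun p => α (meridian p) * ((w p)⁻¹ * f p) := fun f hf =>
    dα.mul_of_sub_one (by norm_num) (dw.mul_of_sub_one (by norm_num) hf)
  have dχ := decays_chi hdata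
  set a : E 2 → ℝ := fun p => α (meridian p) * ((w p)⁻¹ * (1 / 2 * (chi γ K p 0 0 - chi γ K p 1 1)))
  set b : E 2 → ℝ := fun p => α (meridian p) * ((w p)⁻¹ * chi γ K p 0 1)
  have da : Decays (-3 / 2) a := dk _ (((dχ 0 0).sub (dχ 1 1)).const_mul (1 / 2))
  have db : Decays (-3 / 2) b := dk _ (dχ 0 1)
  have k00 : ∀ p, α (meridian p) * kMixed γ K 0 0 p = a p := by
    intro p; rw [kMixed_isothermal hw hq, kLow_isothermal hw hq]; simp only [a]; simp; ring_nf; simp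
  have k01 : ∀ p, α (meridian p) * kMixed γ K 0 1 p = b p := by
    intro p; rw [kMixed_isothermal hw hq, kLow_isothermal hw hq]; simp [b]
  have k10 : ∀ p, α (meridian p) * kMixed γ K 1 0 p = b p := by
    intro p; rw [kMixed_isothermal hw hq, kLow_isothermal hw hq, chi_symm hdata 1 0]; simp [b]
  have k11 : ∀ p, α (meridian p) * kMixed γ K 1 1 p = -1 * a p := by
    intro p; rw [kMixed_isothermal hw hq, kLow_isothermal hw hq]; simp [a]; ring
  have hαr : ∀ p, α (meridian (reflect p)) = α (meridian p) := fun p => by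
    rw [meridian_reflect, lapse_halfTurn hdata hα]
  have hwr : ∀ p, w (reflect p) = w p := fun p => by
    rw [← hq00, qMetric_reflect hdata, rhoSign_sq, one_mul, hq00]
  have ar : ∀ p, a (reflect p) = a p := fun p => by
    simp only [a, hαr, hwr, chi_reflect hdata, rhoSign_sq, one_mul]
  have br : ∀ p, b (reflect p) = -b p := fun p => by
    simp only [b, hαr, hwr, chi_reflect hdata]
    simp [rhoSign]
  obtain ⟨U, V, dU, dV, e1, e2⟩ := exists_cauchyRiemann da db
  set β : Fin 2 → E 2 → ℝ := ![U, V] with hβ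
  have dβ : ∀ i, Decays (-1 / 2) (β i) := by
    intro i; fin_cases i
    · exact dU
    · exact dV
  have sol : IsShiftSolution γ K α β :=
    isShiftSolution_of_cauchyRiemann da.1 db.1 k00 k01 k10 k11 dβ e1 e2
  have dUr : Decays (-1 / 2) fun p => U (flip rhoSign rhoSign_sq p) := dU.comp_isometry _
  have dVr : Decays (-1 / 2) fun p => V (flip rhoSign rhoSign_sq p) := dV.comp_isometry _
  have pU : ∀ i p, pd i (fun p => -1 * U (flip rhoSign rhoSign_sq p)) p =
      -(rhoSign i * pd i U (reflect p)) := by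
    intro i p
    rw [pd_const_mul dUr.1.differentiable_infty, pd_comp_flip dU.1.differentiable_infty,
      reflect_eq_flip]
    ring
  have pV : ∀ i p, pd i (fun p => V (flip rhoSign rhoSign_sq p)) p =
      rhoSign i * pd i V (reflect p) := by
    intro i p
    rw [pd_comp_flip dV.1.differentiable_infty, reflect_eq_flip]
  -- Since `a` is even and `b` odd, the reflected field satisfies the same first-order system, and
  -- uniqueness turns this into the parity conditions.
  have sol' : IsShiftSolution γ K α ![fun p => -1 * U (flip rhoSign rhoSign_sq p),
      fun p => V (flip rhoSign rhoSign_sq p)] := by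
    refine isShiftSolution_of_cauchyRiemann da.1 db.1 k00 k01 k10 k11 ?_ ?_ ?_
    · intro i; fin_cases i
      · exact dUr.const_mul (-1)
      · exact dVr
    · intro p
      have := e1 (reflect p)
      rw [ar] at this
      simp only [Matrix.cons_val_zero, Matrix.cons_val_one, pU, pV]
      simp [rhoSign]
      linarith
    · intro p
      have := e2 (reflect p)
      rw [br] at this
      simp only [Matrix.cons_val_zero, Matrix.cons_val_one, pU, pV]
      simp [rhoSign]
      linarith
  have hsym := sol.unique sol'
  have odd : ∀ p, U (reflect p) = -U p := by
    intro p
    have := congrFun (congrFun hsym 0) p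
    simp only [hβ, Matrix.cons_val_zero, ← reflect_eq_flip] at this
    linarith
  have even : ∀ p, V (reflect p) = V p := by
    intro p
    have := congrFun (congrFun hsym 1) p
    simpa only [hβ, Matrix.cons_val_one, Matrix.cons_val_zero, ← reflect_eq_flip] using this
  refine ⟨β, sol, fun β' h' => sol.unique h', odd, even, fun i j p => ?_, ?_⟩
  · rw [conformalKilling_isothermal hw hws.differentiable_infty hq
      fun i => (dβ i).1.differentiable_infty]
    have hk : ∀ i j, 2 * α (meridian p) * kLow γ K p i j =
        w p * (2 * (α (meridian p) * kMixed γ K i j p)) := by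
      intro i j
      have := hw p
      rw [kMixed_isothermal hw hq]
      field_simp
    rw [hk]
    congr 1
    have h1 := e1 p
    have h2 := e2 p
    fin_cases i <;> fin_cases j
    · simp [k00, hβ]; linarith
    · simp [k01, hβ]; linarith
    · simp [k10, hβ]; linarith
    · simp [k11, hβ]; linarith
  -- Points of the axis are fixed by the reflection, so the odd component vanishes there.
  · obtain ⟨g, dg, hg⟩ := exists_div_rho (by norm_num) dU fun p hp => by
      have h1 := odd p
      have h2 : reflect p = p := by
        ext i; fin_cases i <;> simp [reflect, hp]
      rw [h2] at h1
      linarith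
    refine ⟨g, dg.1, fun p hp => ?_, ?_⟩
    · rw [eq_div_iff hp, mul_comm]
      exact hg p
    · have := dg.isLittleOInfty
      rwa [show (-1 / 2 - 1 : ℝ) = -3 / 2 by norm_num] at this
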